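/- Let $X,Y$ be compact metric spaces, $\mu\in\mathcal P(X)$, $\nu\in\mathcal P(Y)$ Borel probability measures, $f\in C(X\times Y,\mathbb R^M)$, $g\in C(X\times Y,\mathbb R^N)$. Let $\Pi(\mu,\nu)$ be the set of probability measures on $X\times Y$ with marginals $\mu,\nu$, write $\pi=\mu\otimes\pi_x$ for the disintegration of $\pi\in\Pi(\mu,\nu)$, and let $\Pi_g(\mu,\nu)$ be the set of $\pi\in\Pi(\mu,\nu)$ with $\int_Y g(x,y)\,d\pi_x(y)=0$ for $\mu$-a.e. $x$. Assume: (H1) $\theta:\mathbb R^M\to[0,+\infty)$ is convex. (H2) $c:X\times\mathcal P(Y)\to[0,+\infty]$ is Borel ($\mathcal P(Y)$ carrying the weak topology), for every $x$ the map $c(x,\cdot)$ is convex, lower semicontinuous and proper, and $\int_X c(x,\widetilde\pi_x)\,d\mu(x)<+\infty$ for some $\widetilde\pi\in\Pi_g(\mu,\nu)$. (H3) $K\subset C(Y)$ is convex and compact (for the uniform norm), and for all $(x,p)\in X\times\mathcal P(Y)$ $$c(x,p)=\sup_{\gamma\in K}\Big\{\int_Y\gamma\,dp-c^*(x,\gamma)\Big\},\qquad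 c^*(x,\gamma):=\sup_{q\in\mathcal P(Y)}\Big\{\int_Y\gamma\,dq-c(x,q)\Big\}.$$ For $\pi\in\Pi_g(\mu,\nu)$ and $\varepsilon>0$ put $$J(\pi)=\int_X c(x,\pi_x)\,d\mu(x)+\int_X\theta\Big(\int_Y f(x,y)\,d\pi_x(y)\Big)d\mu(x),\qquad J_\varepsilon(\pi)=J(\pi)+\varepsilon H(\pi\,|\,\mu\otimes\nu),$$ where $H$ is the relative entropy. For $\xi=(\phi,\psi,\lambda,\alpha,\beta)\in E:=C(X)\times C(Y)\times C(X,\mathbb R^M)\times C(X,\mathbb R^N)\times C(X\times Y)$ put $$\Lambda\xi(x,y)=\beta(x,y)+\lambda(x)\cdot f(x,y)+\alpha(x)\cdot g(x,y)-\phi(x)-\psi(y),$$ $$F(\xi)=\int_X[c^*(x,\beta(x,\cdot))+\theta^*(\lambda(x))]\,d\mu(x)-\int_X\phi\,d\mu-\int_Y\psi\,d\nu\quad\text{if }\beta(x,\cdot)\in K\text{ for every }x\in X,$$ and $F(\xi)=+\infty$ otherwise, where $\theta^*$ is the Legendre transform of $\theta$. Let $C(\theta,f)$ be the (best) Lipschitz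 constant of $\theta$ on the ball of $\mathbb R^M$ centered at $0$ with radius $\|f\|_\infty+1$. **(Theorem 3.1)** (a) $J$ attains its minimum on $\Pi_g(\mu,\nu)$ and $$\min_{\pi\in\Pi_g(\mu,\nu)}J(\pi)=\sup_{\xi\in E:\ \Lambda\xi\ge0}\{-F(\xi)\}.$$ (b) Let $\varepsilon>0$ and assume moreover that $\int_X c(x,\widetilde\pi_x)\,d\mu(x)+\varepsilon H(\widetilde\pi\,|\,\mu\otimes\nu)<+\infty$ for some $\widetilde\pi\in\Pi_g(\mu,\nu)$. Then $J_\varepsilon$ attains its minimum on $\Pi_g(\mu,\nu)$ and $$\min_{\pi\in\Pi_g(\mu,\nu)}J_\varepsilon(\pi)=\sup_{\xi\in E}\Big\{-F(\xi)-\varepsilon\int_{X\times Y}e^{-\Lambda\xi/\varepsilon}\,d(\mu\otimes\nu)\Big\}+\varepsilon.$$ (c) Adding the constraint $\|\lambda\|_\infty\le C(\theta,f)$ changes neither the value of $\inf\{F(\xi):\xi\in E,\ \Lambda\xi\ge0\}$ nor, under the assumption of (b), that of $\inf_{\xi\in E}\{F(\xi)+\varepsilon\int e^{-\Lambda\xi/\varepsilon}\,d(\mu\otimes\nu)\}$.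 (d) If in addition (H4) $\int_{X\times Y}g\,d\pi=0$ for every $\pi\in\Pi(\mu,\nu)$, then adding the constraint $\int_X\alpha\,d\mu=0$, alone or together with $\|\lambda\|_\infty\le C(\theta,f)$, does not change these values either. -/

import Mathlib

open MeasureTheory Set
open scoped ENNReal NNReal

noncomputable section

namespace WeakOT

/-- `ℝ^d` with the usual scalar product and the Euclidean norm. -/
abbrev Vec (d : ℕ) : Type := EuclideanSpace ℝ (Fin d)

section General

variable {X Y : Type*}
  [MetricSpace X] [CompactSpace X] [MeasurableSpace X] [BorelSpace X]
  [MetricSpace Y] [CompactSpace Y] [MeasurableSpace Y] [BorelSpace Y]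
  {M N : ℕ}

/-- The Lebesgue integral `∫ h⁺ dm - ∫ h⁻ dm` of an extended-real-valued function, with values in
`[-∞, +∞]`; it is used for measurable functions at least one of whose two parts has a finite
integral. -/
def extIntegral {Z : Type*} [MeasurableSpace Z] (m : Measure Z) (h : Z → EReal) : EReal :=
  ((∫⁻ z, (h z).toENNReal ∂m : ℝ≥0∞) : EReal) - ((∫⁻ z, (-h z).toENNReal ∂m : ℝ≥0∞) : EReal)

/-! ### Transport plans and the primal problems -/

/-- `Π(μ, ν)`: the probability measures on `X × Y` with marginals `μ` and `ν`. -/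
def couplings (μ : ProbabilityMeasure X) (ν : ProbabilityMeasure Y) :
    Set (ProbabilityMeasure (X × Y)) :=
  {π | (π : Measure (X × Y)).fst = (μ : Measure X) ∧ (π : Measure (X × Y)).snd = (ν : Measure Y)}

/-- `π_x`: the disintegration of `π` with respect to its first marginal. -/
def disint [Nonempty Y] (π : ProbabilityMeasure (X × Y)) (x : X) : ProbabilityMeasure Y :=
  ⟨(π : Measure (X × Y)).condKernel x, inferInstance⟩

/-- `Π_g(μ, ν)`: the transport plans with `∫ g(x, y) dπ_x(y) = 0` for `μ`-a.e. `x`. -/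
def momentCouplings [Nonempty Y] (μ : ProbabilityMeasure X) (ν : ProbabilityMeasure Y)
    (g : C(X × Y, Vec N)) : Set (ProbabilityMeasure (X × Y)) :=
  {π | π ∈ couplings μ ν ∧
    ∀ᵐ x ∂(μ : Measure X), ∫ y, g (x, y) ∂(disint π x : Measure Y) = 0}

/-- `∫ c(x, π_x) dμ(x)`. -/
def weakCost [Nonempty Y] (μ : ProbabilityMeasure X) (c : X → ProbabilityMeasure Y → ℝ≥0∞)
    (π : ProbabilityMeasure (X × Y)) : ℝ≥0∞ :=
  ∫⁻ x, c x (disint π x) ∂(μ : Measure X)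

/-- `J(π) = ∫ c(x, π_x) dμ(x) + ∫ θ(∫ f(x, y) dπ_x(y)) dμ(x)`, for nonnegative `θ`. -/
def primalJ [Nonempty Y] (μ : ProbabilityMeasure X) (c : X → ProbabilityMeasure Y → ℝ≥0∞)
    (θ : Vec M → ℝ) (f : C(X × Y, Vec M)) (π : ProbabilityMeasure (X × Y)) : ℝ≥0∞ :=
  weakCost μ c π +
    ∫⁻ x, ENNReal.ofReal (θ (∫ y, f (x, y) ∂(disint π x : Measure Y))) ∂(μ : Measure X)

/-- The relative entropy `H(π | μ ⊗ ν)`. -/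
def entropy (μ : ProbabilityMeasure X) (ν : ProbabilityMeasure Y)
    (π : ProbabilityMeasure (X × Y)) : ℝ≥0∞ :=
  InformationTheory.klDiv (π : Measure (X × Y)) ((μ : Measure X).prod (ν : Measure Y))

/-- `J_ε(π) = J(π) + ε H(π | μ ⊗ ν)`, for `ε > 0`. -/
def primalJEps [Nonempty Y] (ε : ℝ) (μ : ProbabilityMeasure X) (ν : ProbabilityMeasure Y)
    (c : X → ProbabilityMeasure Y → ℝ≥0∞) (θ : Vec M → ℝ) (f : C(X × Y, Vec M))
    (π : ProbabilityMeasure (X × Y)) : ℝ≥0∞ :=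
  primalJ μ c θ f π + ENNReal.ofReal ε * entropy μ ν π

/-! ### Assumptions on the weak cost -/

/-- The cost is Borel on `X × P(Y)`, and `c(x, ·)` is convex, lower semicontinuous and proper on
`P(Y)` for every `x`, where `P(Y)` carries the topology of weak convergence. -/
structure IsWeakCost (c : X → ProbabilityMeasure Y → ℝ≥0∞) : Prop where
  borel : Measurable[borel (X × ProbabilityMeasure Y)] (fun z : X × ProbabilityMeasure Y => c z.1 z.2)
  convex : ∀ (x : X) (p q r : ProbabilityMeasure Y) (s t : ℝ≥0), s + t = 1 →
    (r : Measure Y) = s • (p : Measure Y) + t • (q : Measure Y) →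
    c x r ≤ s * c x p + t * c x q
  lsc : ∀ x : X, LowerSemicontinuous (c x)
  proper : ∀ x : X, ∃ p, c x p ≠ ⊤

/-- `c^*(x, γ) = sup_q {∫ γ dq - c(x, q)}`, the supremum being over all `q ∈ P(Y)`. -/
def costConj (c : X → ProbabilityMeasure Y → ℝ≥0∞) (x : X) (γ : C(Y, ℝ)) : EReal :=
  ⨆ q : ProbabilityMeasure Y, ((∫ y, γ y ∂(q : Measure Y) : ℝ) : EReal) - ((c x q : ℝ≥0∞) : EReal)

/-- `K` is a convex compact subset of `C(Y)` on which the dual representation of the cost,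
`c(x, p) = sup_{γ ∈ K} {∫ γ dp - c^*(x, γ)}`, holds. -/
structure IsDualSet (c : X → ProbabilityMeasure Y → ℝ≥0∞) (K : Set C(Y, ℝ)) : Prop where
  convex : Convex ℝ K
  compact : IsCompact K
  repr : ∀ (x : X) (p : ProbabilityMeasure Y),
    ((c x p : ℝ≥0∞) : EReal) =
      ⨆ γ ∈ K, ((∫ y, γ y ∂(p : Measure Y) : ℝ) : EReal) - costConj c x γ

/-! ### The dual problems -/

/-- `θ^*(v) = sup_u {v · u - θ(u)}`. -/
def legendre (θ : Vec M → ℝ) (v : Vec M) : EReal :=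
  ⨆ u : Vec M, ((inner ℝ v u - θ u : ℝ) : EReal)

/-- The space `E = C(X) × C(Y) × C(X, ℝ^M) × C(X, ℝ^N) × C(X × Y)` of the dual variables
`ξ = (φ, ψ, λ, α, β)`. -/
abbrev DualSpace (X Y : Type*) [TopologicalSpace X] [TopologicalSpace Y] (M N : ℕ) : Type _ :=
  C(X, ℝ) × C(Y, ℝ) × C(X, Vec M) × C(X, Vec N) × C(X × Y, ℝ)

/-- The component `λ` of `ξ = (φ, ψ, λ, α, β)`. -/
def dualLam (ξ : DualSpace X Y M N) : C(X, Vec M) := ξ.2.2.1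

/-- The component `α` of `ξ = (φ, ψ, λ, α, β)`. -/
def dualAlpha (ξ : DualSpace X Y M N) : C(X, Vec N) := ξ.2.2.2.1

/-- `Λξ(x, y) = β(x, y) + λ(x) · f(x, y) + α(x) · g(x, y) - φ(x) - ψ(y)`. -/
def Lam (f : C(X × Y, Vec M)) (g : C(X × Y, Vec N)) : DualSpace X Y M N → C(X × Y, ℝ)
  | (φ, ψ, l, α, β) =>
    { toFun := fun z =>
        β z + inner ℝ (l z.1) (f z) + inner ℝ (α z.1) (g z) - φ z.1 - ψ z.2
      continuous_toFun := by fun_prop }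

open Classical in
/-- `F(ξ) = ∫ [c^*(x, β_x) + θ^*(λ(x))] dμ(x) - ∫ φ dμ - ∫ ψ dν` if `β_x ∈ K` for every `x`, and
`F(ξ) = +∞` otherwise. -/
def dualF (μ : ProbabilityMeasure X) (ν : ProbabilityMeasure Y)
    (c : X → ProbabilityMeasure Y → ℝ≥0∞) (θ : Vec M → ℝ) (K : Set C(Y, ℝ)) :
    DualSpace X Y M N → EReal
  | (φ, ψ, l, _, β) =>
    if ∀ x, β.curry x ∈ K then
      extIntegral (μ : Measure X) (fun x => costConj c x (β.curry x) + legendre θ (l x))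
        - ((∫ x, φ x ∂(μ : Measure X) : ℝ) : EReal) - ((∫ y, ψ y ∂(ν : Measure Y) : ℝ) : EReal)
    else ⊤

open Classical in
/-- `G(h) = 0` if `h ≥ 0` on `X × Y`, and `G(h) = +∞` otherwise. -/
def penalty (h : C(X × Y, ℝ)) : EReal := if ∀ z, 0 ≤ h z then 0 else ⊤

/-- `G_ε(h) = ε ∫ exp(-h / ε) d(μ ⊗ ν)`. -/
def penaltyEps (ε : ℝ) (μ : ProbabilityMeasure X) (ν : ProbabilityMeasure Y)
    (h : C(X × Y, ℝ)) : ℝ :=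
  ε * ∫ z, Real.exp (-(h z) / ε) ∂((μ : Measure X).prod (ν : Measure Y))

/-- `inf {F(ξ) + G(Λξ) : ξ ∈ S}`: the dual problem with the extra constraint `ξ ∈ S`. -/
def dualInf (μ : ProbabilityMeasure X) (ν : ProbabilityMeasure Y)
    (c : X → ProbabilityMeasure Y → ℝ≥0∞) (θ : Vec M → ℝ) (f : C(X × Y, Vec M))
    (g : C(X × Y, Vec N)) (K : Set C(Y, ℝ)) (S : Set (DualSpace X Y M N)) : EReal :=
  ⨅ ξ ∈ S, dualF μ ν c θ K ξ + penalty (Lam f g ξ)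

/-- `inf {F(ξ) + G_ε(Λξ) : ξ ∈ S}`: the entropic dual problem with the extra constraint `ξ ∈ S`. -/
def dualInfEps (ε : ℝ) (μ : ProbabilityMeasure X) (ν : ProbabilityMeasure Y)
    (c : X → ProbabilityMeasure Y → ℝ≥0∞) (θ : Vec M → ℝ) (f : C(X × Y, Vec M))
    (g : C(X × Y, Vec N)) (K : Set C(Y, ℝ)) (S : Set (DualSpace X Y M N)) : EReal :=
  ⨅ ξ ∈ S, dualF μ ν c θ K ξ + ((penaltyEps ε μ ν (Lam f g ξ) : ℝ) : EReal)

/-- `C(θ, f)`: the (best) Lipschitz constant of `θ` on the ball of `ℝ^M` centered at `0` with radius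
`‖f‖_∞ + 1`. -/
def lipConst (θ : Vec M → ℝ) (f : C(X × Y, Vec M)) : ℝ≥0 :=
  sInf {L : ℝ≥0 | LipschitzOnWith L θ (Metric.ball 0 (‖f‖ + 1))}

/-- The constraint `‖λ‖_∞ ≤ C(θ, f)`. -/
def boundedLam (N : ℕ) (θ : Vec M → ℝ) (f : C(X × Y, Vec M)) : Set (DualSpace X Y M N) :=
  {ξ | ‖dualLam ξ‖ ≤ lipConst θ f}

/-- The constraint `∫ α dμ = 0`. -/
def zeroMeanAlpha (M : ℕ) (μ : ProbabilityMeasure X) : Set (DualSpace X Y M N) :=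
  {ξ | ∫ x, dualAlpha ξ x ∂(μ : Measure X) = 0}

end General

end WeakOT

end

/-!
The duality is a minimax theorem on the compact space of all probability measures on `X × Y`.
Consider `L(π, (ξ, h)) = ∫ (Λξ - h) dπ - F(ξ) - G(h)`, affine and continuous in `π` and concave in
`(ξ, h)`, where `G` is the penalty (concentrated at `h = 0` without entropy). The supremum over
`(ξ, h)` is the primal functional: the variables `φ`, `ψ`, `α` occur linearly and impose the
marginals and the moment constraint, `β` and `λ` produce `c` and `θ` by conjugation, and `h`
produces the entropy. The infimum over `π` is attained at a Dirac mass, and absorbing the minimum of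
`Λξ - h` into `φ` turns it into a dual value. The minimax principle (`exists_forall_le_of_concaveOn`) thus
yields at once a plan whose primal value is at most the dual value
(`exists_plan_of_dual_le`), and weak duality (`dualF_eq_top_or_exists`) makes it a minimizer.

Two facts keep measure-theoretic subtleties away. Because the dual set `K` is compact, the cost is
finite, with oscillation in `p` bounded uniformly in `x`, and continuous in `p`; hence countable
dense sets compute both `c` and `c^*`, and everything in sight is measurable and integrable. And the
passage from pointwise suprema to suprema over continuous selections
(`exists_continuous_weights_partialSups`) needs only averages with continuous weights, since all the
integrands are concave in the selected variable. It is used three times: for `c`, for `θ`, and for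
the Donsker–Varadhan formula (`klDiv_le_of_forall_continuousMap`).

The extra constraints cost nothing because the strong duality is proved with dual variables that
satisfy them already. The slopes `λ` may be taken among convex combinations of subgradients of `θ`
on the ball of radius `‖f‖_∞ + 1`, which have norm at most `C(θ, f)`. If every coupling has zero
`g`-moment, then replacing `α` by `α - ∫ α dμ` does not change `∫ α · g dπ`, so the test functions
of mean zero still enforce the moment constraint.
-/

noncomputable section

namespace WeakOT

set_option linter.unusedSectionVars false

/-! ### Minimax and subgradients -/

/-- A minimax principle for a function that is affine and continuous on a compact space, "affine"
meaning only that every pair of points has mixtures along which `L` interpolates linearly, and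
concave in its second variable. -/
theorem exists_forall_le_of_concaveOn {P E : Type*} [TopologicalSpace P] [CompactSpace P]
    [Nonempty P] [AddCommGroup E] [Module ℝ E] {D : Set E} {L : P → E → ℝ} {r : ℝ}
    (hcont : ∀ d ∈ D, Continuous fun p => L p d)
    (hmix : ∀ p q : P, ∀ s t : ℝ, 0 ≤ s → 0 ≤ t → s + t = 1 →
      ∃ m, ∀ d ∈ D, L m d = s * L p d + t * L q d)
    (hconc : ∀ p, ConcaveOn ℝ D (L p)) (hle : ∀ d ∈ D, ∃ p, L p d ≤ r) :
    ∃ p, ∀ d ∈ D, L p d ≤ r := by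
  suffices h : (univ ∩ ⋂ d : D, {p | L p d ≤ r}).Nonempty by
    obtain ⟨p, -, hp⟩ := h
    exact ⟨p, fun d hd => mem_iInter.1 hp ⟨d, hd⟩⟩
  refine isCompact_univ.inter_iInter_nonempty _
    (fun d => isClosed_le (hcont d d.2) continuous_const) fun u => ?_
  by_contra hempty
  classical
  let V : P → u → ℝ := fun p i => L p i
  have hVcont : Continuous V := continuous_pi fun i => hcont _ i.1.2
  have hS : Convex ℝ (range V) := by
    rintro _ ⟨p, rfl⟩ _ ⟨q, rfl⟩ s t hs ht hst
    obtain ⟨m, hm⟩ := hmix p q s t hs ht hst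
    exact ⟨m, funext fun i => by simp [V, hm _ i.1.2]⟩
  have hN : Convex ℝ (Iic fun _ : u => r) := convex_Iic _
  have hdisj : Disjoint (range V) (Iic fun _ : u => r) := by
    rw [Set.disjoint_left]
    rintro _ ⟨p, rfl⟩ hp
    refine hempty ⟨p, mem_univ _, mem_iInter₂.2 fun i hi => ?_⟩
    exact hp ⟨i, hi⟩
  obtain ⟨f, a, b, hfa, hab, hfb⟩ := geometric_hahn_banach_compact_closed hS
    (isCompact_range hVcont) hN isClosed_Iic hdisj
  let w : u → ℝ := fun i => -f (Pi.single i 1)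
  have hf : ∀ v, f v = -∑ i, w i * v i := by
    intro v
    have := LinearMap.pi_apply_eq_sum_univ (f : (u → ℝ) →ₗ[ℝ] ℝ) v
    simp only [ContinuousLinearMap.coe_coe] at this
    rw [this, ← Finset.sum_neg_distrib]
    refine Finset.sum_congr rfl fun i _ => ?_
    simp only [w, smul_eq_mul, neg_mul, neg_neg]
    rw [mul_comm]
    congr 2
    ext j
    simp [Pi.single_apply, eq_comm]
  have hw : ∀ i, 0 ≤ w i := by
    intro i
    by_contra! hi
    -- moving down the `i`-th axis inside the orthant would drive `f` to `-∞`
    let t : ℝ := (|b| + |f fun _ => r|) / (-w i)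
    have ht : 0 ≤ t := div_nonneg (by positivity) (by linarith)
    have hmem : ((fun _ : u => r) - t • Pi.single i (1 : ℝ)) ∈ Iic fun _ : u => r := by
      rw [mem_Iic, sub_le_self_iff]
      exact smul_nonneg ht (by rw [Pi.single_nonneg]; exact zero_le_one)
    have h1 := hfb _ hmem
    rw [map_sub, map_smul, show f (Pi.single i (1 : ℝ)) = -w i by simp [w], smul_eq_mul,
      div_mul_cancel₀ _ (by linarith)] at h1
    linarith [neg_abs_le b, le_abs_self (f fun _ => r), le_abs_self b, abs_nonneg b]
  have hr := hfb (fun _ => r) (mem_Iic.2 le_rfl)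
  have hP : ∀ p, r * ∑ i, w i < ∑ i, w i * L p i := by
    intro p
    have h1 := hfa _ (mem_range_self p)
    rw [hf] at h1 hr
    rw [← Finset.sum_mul] at hr
    simp only [V] at h1
    linarith [mul_comm r (∑ i, w i)]
  have hpos : 0 < ∑ i, w i := by
    rcases (Finset.sum_nonneg fun i _ => hw i).lt_or_eq with h | h
    · exact h
    · have h0 : ∀ i, w i = 0 := fun i =>
        (Finset.sum_eq_zero_iff_of_nonneg fun i _ => hw i).1 h.symm i (Finset.mem_univ _)
      have := hP (Classical.arbitrary P)
      simp [h0] at this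
  set W := ∑ i, w i
  have hsum : ∑ i, w i / W = 1 := by rw [← Finset.sum_div]; exact div_self hpos.ne'
  have hD : ∀ p, ∑ i, w i / W * L p i ≤ L p (∑ i, (w i / W) • (i : E)) := fun p => by
    have := (hconc p).le_map_sum (t := Finset.univ) (w := fun i => w i / W)
      (p := fun i : u => ((i : D) : E)) (fun i _ => div_nonneg (hw i) hpos.le) hsum
      (fun i _ => i.1.2)
    simpa using this
  obtain ⟨p, hp⟩ := hle (∑ i, (w i / W) • ((i : D) : E))
    ((hconc (Classical.arbitrary P)).1.sum_mem (fun i _ => div_nonneg (hw i) hpos.le) hsum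
      fun i _ => i.1.2)
  have h1 : ∑ i, w i / W * L p i = (∑ i, w i * L p i) / W := by
    rw [Finset.sum_div]; exact Finset.sum_congr rfl fun i _ => by ring
  have h2 := hD p
  rw [h1] at h2
  have h3 : r < (∑ i, w i * L p i) / W := by rw [lt_div_iff₀ hpos]; exact hP p
  linarith

/-- A convex function on a finite-dimensional space has a subgradient at every point. -/
theorem exists_subgradient {d : ℕ} {θ : Vec d → ℝ} (hθ : ConvexOn ℝ univ θ) (u : Vec d) :
    ∃ v : Vec d, ∀ u', θ u + inner ℝ v (u' - u) ≤ θ u' := by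
  have hcont : Continuous θ := by
    rw [← continuousOn_univ]; exact hθ.continuousOn isOpen_univ
  have hopen : IsOpen {p : Vec d × ℝ | p.1 ∈ univ ∧ θ p.1 < p.2} := by
    simp only [mem_univ, true_and]
    exact isOpen_lt (hcont.comp continuous_fst) continuous_snd
  obtain ⟨F, hF⟩ := geometric_hahn_banach_open_point (x := (u, θ u)) hθ.convex_strict_epigraph hopen
    (by simp)
  let l : Vec d →L[ℝ] ℝ := F.comp (ContinuousLinearMap.inl ℝ _ _)
  let s : ℝ := F (0, 1)
  have hFs : ∀ a b, F (a, b) = l a + b * s := by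
    intro a b
    have : (a, b) = (a, (0 : ℝ)) + b • ((0 : Vec d), (1 : ℝ)) := by simp
    rw [this, map_add, map_smul]
    simp [l, s]
  have key : ∀ u' t, θ u' < t → l u' + t * s < l u + θ u * s := by
    intro u' t ht
    have := hF (u', t) ⟨mem_univ _, ht⟩
    rwa [hFs, hFs] at this
  have hs : s < 0 := by
    have := key u (θ u + 1) (by linarith)
    linarith
  have key' : ∀ u', l u' + θ u' * s ≤ l u + θ u * s := by
    intro u'
    by_contra! h
    have := key u' (θ u' + (l u' + θ u' * s - (l u + θ u * s)) / (-s))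
      (by have := div_pos (sub_pos.2 h) (neg_pos.2 hs); linarith)
    have h2 : (l u' + θ u' * s - (l u + θ u * s)) / (-s) * s
        = -(l u' + θ u' * s - (l u + θ u * s)) := by
      rw [div_neg, neg_mul, div_mul_cancel₀ _ hs.ne]
    rw [add_mul, h2] at this
    linarith
  refine ⟨(InnerProductSpace.toDual ℝ (Vec d)).symm ((-s)⁻¹ • l), fun u' => ?_⟩
  rw [InnerProductSpace.toDual_symm_apply]
  have := key' u'
  simp only [smul_apply, smul_eq_mul, map_sub]
  have h3 : (-s)⁻¹ * (l u' - l u) ≤ θ u' - θ u := by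
    rw [inv_mul_le_iff₀ (by linarith)]
    linarith
  linarith

/-! ### Interchange of supremum and integral -/

section Interchange

theorem integrable_partialSups {Z : Type*} [MeasurableSpace Z] {m : Measure Z} {Φ : ℕ → Z → ℝ}
    (hΦi : ∀ n, Integrable (Φ n) m) (n : ℕ) : Integrable (partialSups Φ n) m := by
  induction n with
  | zero => simpa using hΦi 0
  | succ n ihn => rw [← Order.succ_eq_add_one, partialSups_succ]; exact ihn.sup (hΦi _)

variable {Z : Type*} [MetricSpace Z] [CompactSpace Z] [MeasurableSpace Z] [BorelSpace Z]

theorem integrable_continuousMap {E : Type*} [NormedAddCommGroup E] [SecondCountableTopology E]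
    (m : Measure Z) [IsFiniteMeasure m] (k : C(Z, E)) : Integrable (fun z => k z) m :=
  k.continuous.integrable_of_hasCompactSupport (HasCompactSupport.of_compactSpace _)

theorem integrable_continuousMap_mul {m : Measure Z} {A : Z → ℝ} (hA : Integrable A m)
    (k : C(Z, ℝ)) : Integrable (fun z => k z * A z) m :=
  hA.bdd_mul k.continuous.aestronglyMeasurable (c := ‖k‖)
    (ae_of_all _ fun z => k.norm_coe_le_norm z)

/-- A continuous weight that almost selects the larger of two functions: an approximation of the
indicator of `{B ≤ A}` in `L¹` of the measure with density `|A - B|`. -/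
theorem exists_continuous_weight_max (m : Measure Z) [IsFiniteMeasure m] {A B : Z → ℝ}
    (hA : Measurable A) (hB : Measurable B) (hAi : Integrable A m) (hBi : Integrable B m)
    {δ : ℝ} (hδ : 0 < δ) :
    ∃ τ : C(Z, ℝ), (∀ z, 0 ≤ τ z) ∧ (∀ z, τ z ≤ 1) ∧
      ∫ z, max (A z) (B z) ∂m - δ ≤ ∫ z, (τ z * A z + (1 - τ z) * B z) ∂m := by
  let S : Set Z := {z | B z ≤ A z}
  have hS : MeasurableSet S := measurableSet_le hB hA
  let d : Z → ℝ≥0 := fun z => ‖A z - B z‖₊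
  have hd : Measurable d := (hA.sub hB).nnnorm
  let m' := m.withDensity fun z => (d z : ℝ≥0∞)
  have : IsFiniteMeasure m' := isFiniteMeasure_withDensity (hAi.sub hBi).2.ne
  let ind : Z → ℝ := S.indicator fun _ => 1
  have hind : Integrable ind m' := (integrable_const (1 : ℝ)).indicator hS
  obtain ⟨k, hk, hki⟩ := hind.exists_boundedContinuous_integral_sub_le hδ
  let τ : C(Z, ℝ) := ⟨fun z => max 0 (min 1 (k z)), by fun_prop⟩
  have hind01 : ∀ z, ind z = 0 ∨ ind z = 1 := fun z => by
    by_cases hz : z ∈ S <;> simp [ind, hz]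
  have hτ : ∀ z, |ind z - τ z| ≤ |ind z - k z| := by
    intro z
    have h1 : ind z = max 0 (min 1 (ind z)) := by
      rcases hind01 z with h | h <;> simp [h]
    calc |ind z - τ z| = |max 0 (min 1 (ind z)) - max 0 (min 1 (k z))| := by rw [← h1]; rfl
      _ ≤ max |0 - 0| |min 1 (ind z) - min 1 (k z)| := abs_max_sub_max_le_max _ _ _ _
      _ ≤ |min 1 (ind z) - min 1 (k z)| := by simp
      _ ≤ max |1 - 1| |ind z - k z| := abs_min_sub_min_le_max _ _ _ _
      _ ≤ |ind z - k z| := by simp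
  have hle : ∫ z, |ind z - τ z| ∂m' ≤ δ := by
    refine (integral_mono ?_ (hind.sub hki).norm hτ).trans hk
    exact (hind.sub (integrable_continuousMap m' τ)).abs
  rw [integral_withDensity_eq_integral_smul hd] at hle
  refine ⟨τ, fun z => le_max_left _ _, fun z => max_le zero_le_one (min_le_left _ _), ?_⟩
  have hτi : Integrable (fun z => τ z * A z + (1 - τ z) * B z) m :=
    (integrable_continuousMap_mul hAi τ).add (integrable_continuousMap_mul hBi (1 - τ))
  have hmaxi : Integrable (fun z => max (A z) (B z)) m := hAi.sup hBi
  have hid : ∀ z, max (A z) (B z) - (τ z * A z + (1 - τ z) * B z) =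
      (ind z - τ z) * (A z - B z) := by
    intro z
    by_cases hz : z ∈ S
    · have : B z ≤ A z := hz
      simp only [ind, indicator_of_mem hz, max_eq_left this]
      ring
    · have : A z ≤ B z := (not_le.1 hz).le
      simp only [ind, indicator_of_notMem hz, max_eq_right this]
      ring
  have hdom : Integrable (fun z => d z • |ind z - τ z|) m :=
    (integrable_withDensity_iff_integrable_smul hd).1
      (hind.sub (integrable_continuousMap m' τ)).abs
  have hfin : ∫ z, (max (A z) (B z) - (τ z * A z + (1 - τ z) * B z)) ∂m ≤
      ∫ z, d z • |ind z - τ z| ∂m := by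
    refine integral_mono (hmaxi.sub hτi) hdom fun z => ?_
    simp only [hid]
    refine (le_abs_self _).trans ?_
    rw [abs_mul, mul_comm]
    rfl
  rw [integral_sub hmaxi hτi] at hfin
  linarith

/-- The integral of the maximum of finitely many functions is approached by integrals of their
averages with continuous weights. This replaces a measurable selection followed by Lusin's
theorem. -/
theorem exists_continuous_weights_partialSups (m : Measure Z) [IsFiniteMeasure m]
    {Φ : ℕ → Z → ℝ} (hΦ : ∀ n, Measurable (Φ n)) (hΦi : ∀ n, Integrable (Φ n) m) (N : ℕ) {δ : ℝ}
    (hδ : 0 < δ) :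
    ∃ η : ℕ → C(Z, ℝ), (∀ n z, 0 ≤ η n z) ∧ (∀ z, ∑ n ∈ Finset.range (N + 1), η n z = 1) ∧
      ∫ z, partialSups Φ N z ∂m - δ ≤ ∫ z, ∑ n ∈ Finset.range (N + 1), η n z * Φ n z ∂m := by
  induction N generalizing δ with
  | zero => exact ⟨fun _ => 1, by simp, by simp, by simpa using hδ.le⟩
  | succ N ih =>
    obtain ⟨η, hη0, hη1, hη⟩ := ih (half_pos hδ)
    let A : Z → ℝ := fun z => ∑ n ∈ Finset.range (N + 1), η n z * Φ n z
    have hA : Measurable A := Finset.measurable_sum _ fun n _ =>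
      (η n).continuous.measurable.mul (hΦ n)
    have hAi : Integrable A m := integrable_finsetSum _ fun n _ =>
      integrable_continuousMap_mul (hΦi n) (η n)
    have hsup := integrable_partialSups hΦi
    obtain ⟨τ, hτ0, hτ1, hτ⟩ := exists_continuous_weight_max m hA (hΦ (N + 1)) hAi (hΦi (N + 1))
      (half_pos hδ)
    refine ⟨fun n => if n = N + 1 then 1 - τ else τ * η n, fun n z => ?_, fun z => ?_, ?_⟩
    · dsimp only
      split_ifs
      · simpa using hτ1 z
      · exact mul_nonneg (hτ0 z) (hη0 n z)
    · rw [Finset.sum_range_succ]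
      have : ∀ n ∈ Finset.range (N + 1),
          (if n = N + 1 then 1 - τ else τ * η n) z = τ z * η n z := fun n hn => by
        rw [if_neg (Finset.mem_range.1 hn).ne]; rfl
      rw [Finset.sum_congr rfl this, ← Finset.mul_sum, hη1]
      simp
    · have hval : ∀ z, ∑ n ∈ Finset.range (N + 1 + 1),
          (if n = N + 1 then 1 - τ else τ * η n) z * Φ n z
            = τ z * A z + (1 - τ z) * Φ (N + 1) z := fun z => by
        rw [Finset.sum_range_succ, Finset.mul_sum, if_pos rfl]
        congr 1
        refine Finset.sum_congr rfl fun n hn => ?_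
        rw [if_neg (Finset.mem_range.1 hn).ne, ContinuousMap.mul_apply, mul_assoc]
      simp_rw [hval]
      -- `A` is an average of `Φ 0, …, Φ N`, so the loss in the first `N + 1` functions is pointwise
      -- nonnegative and only grows when the maximum with `Φ (N + 1)` is omitted
      have hAle : ∀ z, A z ≤ partialSups Φ N z := fun z => by
        calc A z ≤ ∑ n ∈ Finset.range (N + 1), η n z * partialSups Φ N z :=
              Finset.sum_le_sum fun n hn => mul_le_mul_of_nonneg_left
                (le_partialSups_of_le Φ (Nat.lt_succ_iff.1 (Finset.mem_range.1 hn)) z) (hη0 n z)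
          _ = partialSups Φ N z := by rw [← Finset.sum_mul, hη1, one_mul]
      have hpt : ∀ z, partialSups Φ (N + 1) z ≤
          max (A z) (Φ (N + 1) z) + (partialSups Φ N z - A z) := fun z => by
        rw [← Order.succ_eq_add_one, partialSups_succ, Order.succ_eq_add_one]
        refine max_le ?_ ?_
        · linarith [le_max_left (A z) (Φ (N + 1) z)]
        · linarith [le_max_right (A z) (Φ (N + 1) z), hAle z]
      have hmaxi : Integrable (fun z => max (A z) (Φ (N + 1) z)) m := hAi.sup (hΦi _)
      have h1 := integral_mono (hsup (N + 1)) (hmaxi.add ((hsup N).sub hAi)) hpt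
      have h2 : ∫ z, (max (A z) (Φ (N + 1) z) + (partialSups Φ N z - A z)) ∂m =
          ∫ z, max (A z) (Φ (N + 1) z) ∂m + (∫ z, partialSups Φ N z ∂m - ∫ z, A z ∂m) := by
        rw [← integral_sub (hsup N) hAi]
        exact integral_add hmaxi ((hsup N).sub hAi)
      have h3 : ∫ z, partialSups Φ (N + 1) z ∂m ≤
          ∫ z, max (A z) (Φ (N + 1) z) ∂m + (∫ z, partialSups Φ N z ∂m - ∫ z, A z ∂m) := by
        rw [← h2]; exact h1
      linarith

/-- The integral of an integrable pointwise supremum of countably many functions is approached by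
integrals of finite averages with continuous weights. -/
theorem exists_continuous_weights_of_isLUB (m : Measure Z) [IsFiniteMeasure m]
    {Φ : ℕ → Z → ℝ} (hΦ : ∀ n, Measurable (Φ n)) (hΦi : ∀ n, Integrable (Φ n) m) {S : Z → ℝ}
    (hS : Integrable S m) (hlub : ∀ z, IsLUB (range fun n => Φ n z) (S z)) {δ : ℝ} (hδ : 0 < δ) :
    ∃ (N : ℕ) (η : ℕ → C(Z, ℝ)), (∀ n z, 0 ≤ η n z) ∧
      (∀ z, ∑ n ∈ Finset.range (N + 1), η n z = 1) ∧
      ∫ z, S z ∂m - δ ≤ ∫ z, ∑ n ∈ Finset.range (N + 1), η n z * Φ n z ∂m := by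
  have htend : Filter.Tendsto (fun n => ∫ z, partialSups Φ n z ∂m) Filter.atTop
      (nhds (∫ z, S z ∂m)) := by
    refine integral_tendsto_of_tendsto_of_monotone (integrable_partialSups hΦi) hS
      (ae_of_all _ fun z i j hij => (partialSups_monotone Φ hij) z) (ae_of_all _ fun z => ?_)
    refine tendsto_atTop_isLUB (fun i j hij => (partialSups_monotone Φ hij) z) ?_
    refine ⟨?_, fun b hb => (hlub z).2 ?_⟩
    · rintro _ ⟨n, rfl⟩
      induction n with
      | zero => simpa using (hlub z).1 ⟨0, rfl⟩
      | succ n ihn =>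
        dsimp only
        rw [← Order.succ_eq_add_one, partialSups_succ]
        exact max_le ihn ((hlub z).1 ⟨_, rfl⟩)
    · rintro _ ⟨n, rfl⟩
      exact (le_partialSups Φ n z).trans (hb ⟨n, rfl⟩)
  obtain ⟨N, hN⟩ := (htend.eventually
    (lt_mem_nhds (show ∫ z, S z ∂m - δ / 2 < ∫ z, S z ∂m by linarith))).exists
  obtain ⟨η, hη0, hη1, hη⟩ := exists_continuous_weights_partialSups m hΦ hΦi N (half_pos hδ)
  exact ⟨N, η, hη0, hη1, by linarith⟩

/-- The integral of a pointwise supremum, possibly infinite, of countably many functions is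
approached by integrals of finite averages with continuous weights. -/
theorem exists_continuous_weights_of_lt_lintegral (m : Measure Z) [IsFiniteMeasure m]
    {Φ : ℕ → Z → ℝ} (hΦ : ∀ n, Measurable (Φ n)) (hΦi : ∀ n, Integrable (Φ n) m)
    (h0 : ∀ z, 0 ≤ Φ 0 z) {a : ℝ}
    (ha : ENNReal.ofReal a < ∫⁻ z, ⨆ n, ENNReal.ofReal (Φ n z) ∂m) :
    ∃ (N : ℕ) (η : ℕ → C(Z, ℝ)), (∀ n z, 0 ≤ η n z) ∧
      (∀ z, ∑ n ∈ Finset.range (N + 1), η n z = 1) ∧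
      a < ∫ z, ∑ n ∈ Finset.range (N + 1), η n z * Φ n z ∂m := by
  have hpm : ∀ n, Measurable (partialSups Φ n) := fun n => by
    induction n with
    | zero => simpa using hΦ 0
    | succ n ihn => rw [← Order.succ_eq_add_one, partialSups_succ]; exact ihn.sup (hΦ _)
  have hle : ∫⁻ z, ⨆ n, ENNReal.ofReal (Φ n z) ∂m ≤
      ∫⁻ z, ⨆ n, ENNReal.ofReal (partialSups Φ n z) ∂m :=
    lintegral_mono fun z => iSup_mono fun n => ENNReal.ofReal_le_ofReal (le_partialSups Φ n z)
  rw [lintegral_iSup (fun n => (hpm n).ennreal_ofReal)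
    (fun i j hij z => ENNReal.ofReal_le_ofReal (partialSups_monotone Φ hij z))] at hle
  obtain ⟨N, hN⟩ := lt_iSup_iff.1 (ha.trans_le hle)
  rw [← ofReal_integral_eq_lintegral_ofReal (integrable_partialSups hΦi N)
    (ae_of_all _ fun z => (h0 z).trans (le_partialSups_of_le Φ (Nat.zero_le N) z))] at hN
  have hN' := (ENNReal.ofReal_lt_ofReal_iff'.1 hN).1
  obtain ⟨η, hη0, hη1, hη⟩ := exists_continuous_weights_partialSups m hΦ hΦi N
    (half_pos (sub_pos.2 hN'))
  exact ⟨N, η, hη0, hη1, by linarith⟩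

end Interchange

/-! ### The extended integral -/

/-- On integrable functions the extended integral is the Bochner integral. -/
theorem extIntegral_eq_integral {Z : Type*} [MeasurableSpace Z] {m : Measure Z} {h : Z → EReal}
    {k : Z → ℝ} (hk : Integrable k m) (hhk : ∀ᵐ z ∂m, h z = k z) :
    extIntegral m h = ((∫ z, k z ∂m : ℝ) : EReal) := by
  have h1 : ∫⁻ z, (h z).toENNReal ∂m = ∫⁻ z, ENNReal.ofReal (k z) ∂m :=
    lintegral_congr_ae (hhk.mono fun z hz => by simp [hz])
  have h2 : ∫⁻ z, (-h z).toENNReal ∂m = ∫⁻ z, ENNReal.ofReal (-k z) ∂m :=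
    lintegral_congr_ae (hhk.mono fun z hz => by
      simp only [hz]; rw [← EReal.coe_neg, EReal.toENNReal_of_ne_top (EReal.coe_ne_top _)]; rfl)
  have hf : ∀ {k : Z → ℝ}, Integrable k m → ∫⁻ z, ENNReal.ofReal (k z) ∂m ≠ ⊤ := fun hk =>
    ((lintegral_mono fun z => ENNReal.ofReal_le_ofReal (le_abs_self _)).trans_lt
      (by simpa using (hasFiniteIntegral_iff_norm _).1 hk.2)).ne
  have hneg : ∫⁻ z, ENNReal.ofReal (-k z) ∂m ≠ ⊤ := hf hk.neg
  rw [extIntegral, h1, h2, integral_eq_lintegral_pos_part_sub_lintegral_neg_part hk,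
    EReal.coe_sub, EReal.coe_ennreal_toReal (hf hk), EReal.coe_ennreal_toReal hneg]

/-- A measurable function whose negative part has a finite integral, and whose extended integral is
finite, agrees almost everywhere with an integrable real function. -/
theorem integrable_toReal_of_extIntegral_ne_top {Z : Type*} [MeasurableSpace Z] {m : Measure Z}
    {h : Z → EReal} (hm : Measurable h) (hbot : ∀ z, h z ≠ ⊥)
    (hneg : ∫⁻ z, (-h z).toENNReal ∂m ≠ ⊤) (htop : extIntegral m h ≠ ⊤) :
    Integrable (fun z => (h z).toReal) m ∧ ∀ᵐ z ∂m, h z = ((h z).toReal : EReal) := by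
  have hpos : ∫⁻ z, (h z).toENNReal ∂m ≠ ⊤ := by
    intro hp
    apply htop
    rw [extIntegral, hp, EReal.coe_ennreal_top]
    exact EReal.top_sub (by simpa using hneg)
  have hae : ∀ᵐ z ∂m, h z = ((h z).toReal : EReal) := by
    filter_upwards [ae_lt_top hm.ereal_toENNReal hpos] with z hz
    rw [EReal.coe_toReal _ (hbot z)]
    rintro h
    simp [h] at hz
  refine ⟨⟨hm.ereal_toReal.aestronglyMeasurable, ?_⟩, hae⟩
  rw [hasFiniteIntegral_iff_norm]
  refine lt_of_le_of_lt (lintegral_mono_ae (g := fun z => (h z).toENNReal + (-h z).toENNReal) ?_) ?_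
  · filter_upwards [hae] with z hz
    rw [hz]
    rw [← EReal.coe_neg, EReal.toENNReal_of_ne_top (EReal.coe_ne_top _),
      EReal.toENNReal_of_ne_top (EReal.coe_ne_top _)]
    simp only [EReal.toReal_coe, Real.norm_eq_abs]
    rcases le_total 0 (h z).toReal with h0 | h0
    · rw [abs_of_nonneg h0]; exact le_self_add
    · rw [abs_of_nonpos h0]; exact le_add_self
  · rw [lintegral_add_left hm.ereal_toENNReal]
    exact ENNReal.add_lt_top.2 ⟨hpos.lt_top, hneg.lt_top⟩

/-! ### Relative entropy as a supremum over continuous functions -/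

/-- Young's inequality for the entropy integrand. -/
theorem mul_sub_exp_le_klFun {w : ℝ} (hw : 0 ≤ w) (a : ℝ) :
    a * w - Real.exp a + 1 ≤ InformationTheory.klFun w := by
  rw [InformationTheory.klFun_apply]
  rcases hw.eq_or_lt with rfl | hw
  · simp [Real.exp_nonneg]
  · have h1 := mul_le_mul_of_nonneg_left (Real.add_one_le_exp (a - Real.log w)) hw.le
    rw [Real.exp_sub, Real.exp_log hw, mul_div_cancel₀ _ hw.ne'] at h1
    linarith

theorem exists_lt_mul_sub_exp {w b : ℝ} (hw : 0 ≤ w) (hb : b < InformationTheory.klFun w) :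
    ∃ a, b < a * w - Real.exp a + 1 := by
  rcases hw.eq_or_lt with rfl | hw
  · rw [InformationTheory.klFun_zero] at hb
    refine ⟨Real.log ((1 - b) / 2), ?_⟩
    rw [Real.exp_log (by linarith)]
    linarith
  · refine ⟨Real.log w, ?_⟩
    rw [InformationTheory.klFun_apply] at hb
    rw [Real.exp_log hw]
    linarith

section

variable {Z : Type*} [MetricSpace Z] [CompactSpace Z] [MeasurableSpace Z] [BorelSpace Z]

theorem integrable_exp_continuousMap (m : Measure Z) [IsFiniteMeasure m] (k : C(Z, ℝ)) :
    Integrable (fun z => Real.exp (k z)) m :=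
  integrable_continuousMap m ⟨fun z => Real.exp (k z), by fun_prop⟩

theorem integral_eq_integral_rnDeriv_mul {π ρ : Measure Z} [IsProbabilityMeasure π]
    [IsProbabilityMeasure ρ] (hac : π ≪ ρ) (k : C(Z, ℝ)) :
    ∫ z, k z ∂π - ∫ z, Real.exp (k z) ∂ρ + 1 =
      ∫ z, (k z * (π.rnDeriv ρ z).toReal - Real.exp (k z) + 1) ∂ρ := by
  have hw : Integrable (fun z => k z * (π.rnDeriv ρ z).toReal) ρ :=
    integrable_continuousMap_mul Measure.integrable_toReal_rnDeriv k
  have he := integrable_exp_continuousMap ρ k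
  have h1 : ∫ z, (k z * (π.rnDeriv ρ z).toReal - Real.exp (k z) + 1) ∂ρ =
      ∫ z, (k z * (π.rnDeriv ρ z).toReal - Real.exp (k z)) ∂ρ + ∫ _, (1 : ℝ) ∂ρ :=
    integral_add (hw.sub he) (integrable_const _)
  rw [h1, integral_sub hw he, ← integral_rnDeriv_smul hac]
  simp [mul_comm]

/-- The easy half of the Donsker–Varadhan formula, in the unnormalized form
`H(π | ρ) = sup_k {∫ k dπ - ∫ exp k dρ + 1}`. -/
theorem integral_sub_integral_exp_le_klDiv {π ρ : Measure Z} [IsProbabilityMeasure π]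
    [IsProbabilityMeasure ρ] (h : InformationTheory.klDiv π ρ ≠ ⊤) (k : C(Z, ℝ)) :
    ∫ z, k z ∂π - ∫ z, Real.exp (k z) ∂ρ + 1 ≤ (InformationTheory.klDiv π ρ).toReal := by
  obtain ⟨hac, hint⟩ := InformationTheory.klDiv_ne_top_iff.1 h
  rw [InformationTheory.toReal_klDiv_eq_integral_klFun hac, integral_eq_integral_rnDeriv_mul hac]
  refine integral_mono ?_ ((InformationTheory.integrable_klFun_rnDeriv_iff hac).2 hint) fun z =>
    mul_sub_exp_le_klFun ENNReal.toReal_nonneg _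
  exact ((integrable_continuousMap_mul Measure.integrable_toReal_rnDeriv k).sub
    (integrable_exp_continuousMap ρ k)).add (integrable_const _)

/-- Large multiples of the indicator of a `ρ`-null set, approximated by continuous functions, would
make the Donsker–Varadhan functional unbounded. -/
theorem absolutelyContinuous_of_forall_continuousMap {π ρ : Measure Z} [IsProbabilityMeasure π]
    [IsProbabilityMeasure ρ] {a : ℝ}
    (h : ∀ k : C(Z, ℝ), ∫ z, k z ∂π - ∫ z, Real.exp (k z) ∂ρ + 1 ≤ a) : π ≪ ρ := by
  refine Measure.AbsolutelyContinuous.mk fun A hA hρ => ?_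
  by_contra hπ
  obtain ⟨F, hFA, hF, hFpos⟩ := hA.exists_lt_isClosed_of_ne_top (μ := π)
    (measure_ne_top _ _) (pos_iff_ne_zero.2 hπ)
  have hρF : ρ F = 0 := measure_mono_null hFA hρ
  have hpos : 0 < π.real F := ENNReal.toReal_pos hFpos.ne' (measure_ne_top _ _)
  obtain ⟨T, hT0, hT⟩ : ∃ T : ℝ, 0 ≤ T ∧ a < T * π.real F :=
    ⟨(|a| + 1) / π.real F, by positivity, by
      rw [div_mul_cancel₀ _ hpos.ne']; linarith [le_abs_self a]⟩
  -- continuous functions decreasing to `T • 1_F`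
  let τ : ℕ → C(Z, ℝ) := fun n =>
    ⟨fun z => T * (thickenedIndicator (δ := 1 / ((n : ℝ) + 1)) (by positivity) F z : ℝ),
      by fun_prop⟩
  have hlow : ∀ n, T * π.real F ≤ ∫ z, τ n z ∂π := by
    intro n
    have : T * π.real F = ∫ z, F.indicator (fun _ => T) z ∂π := by
      rw [integral_indicator_const _ hF.measurableSet, smul_eq_mul, mul_comm]
    rw [this]
    refine integral_mono ((integrable_const _).indicator hF.measurableSet)
      (integrable_continuousMap π _) fun z => ?_
    by_cases hz : z ∈ F
    · have h1 := thickenedIndicator_one (δ := 1 / ((n : ℝ) + 1)) (by positivity) F hz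
      simp only [indicator_of_mem hz, τ, ContinuousMap.coe_mk]
      rw [h1]
      simp
    · simp only [hz, not_false_eq_true, indicator_of_notMem]
      exact mul_nonneg hT0 (NNReal.coe_nonneg _)
  have hlim : Filter.Tendsto (fun n => ∫ z, Real.exp (τ n z) ∂ρ) Filter.atTop
      (nhds (∫ _, (1 : ℝ) ∂ρ)) := by
    refine tendsto_integral_of_dominated_convergence (fun _ => Real.exp T)
      (fun n => (integrable_exp_continuousMap ρ _).1) (integrable_const _) (fun n => ?_) ?_
    · refine ae_of_all _ fun z => ?_
      rw [Real.norm_eq_abs, Real.abs_exp, Real.exp_le_exp]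
      refine mul_le_of_le_one_right hT0 ?_
      exact_mod_cast thickenedIndicator_le_one _ _ _
    · filter_upwards [measure_eq_zero_iff_ae_notMem.1 hρF] with z hz
      have h1 := thickenedIndicator_tendsto_indicator_closure
        (δseq := fun n : ℕ => 1 / ((n : ℝ) + 1)) (fun n => by positivity)
        tendsto_one_div_add_atTop_nhds_zero_nat F
      have h2 := (tendsto_pi_nhds.1 h1) z
      rw [hF.closure_eq, indicator_of_notMem hz] at h2
      have h3 : Filter.Tendsto (fun n => τ n z) Filter.atTop (nhds (T * ((0 : ℝ≥0) : ℝ))) :=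
        ((NNReal.continuous_coe.tendsto _).comp h2).const_mul T
      rw [NNReal.coe_zero, mul_zero] at h3
      simpa [Function.comp_def] using (Real.continuous_exp.tendsto _).comp h3
  have hlt : ∀ n, T * π.real F + 1 - a ≤ ∫ z, Real.exp (τ n z) ∂ρ := fun n => by
    linarith [h (τ n), hlow n]
  have := ge_of_tendsto' hlim hlt
  simp at this
  linarith

/-- The other half of the Donsker–Varadhan formula: continuous test functions suffice to bound the
relative entropy from above. -/
theorem klDiv_le_of_forall_continuousMap {π ρ : Measure Z} [IsProbabilityMeasure π]
    [IsProbabilityMeasure ρ] {a : ℝ}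
    (h : ∀ k : C(Z, ℝ), ∫ z, k z ∂π - ∫ z, Real.exp (k z) ∂ρ + 1 ≤ a) :
    InformationTheory.klDiv π ρ ≤ ENNReal.ofReal a := by
  have hac := absolutelyContinuous_of_forall_continuousMap h
  by_contra! hlt
  -- a dense sequence of slopes, preceded by `0` so that the first integrand vanishes
  let s : ℕ → ℝ := fun n => Nat.casesOn n 0 fun n => TopologicalSpace.denseSeq ℝ n
  let w : Z → ℝ := fun z => (π.rnDeriv ρ z).toReal
  have hw : Measurable w := (Measure.measurable_rnDeriv _ _).ennreal_toReal
  have hwi : Integrable w ρ := Measure.integrable_toReal_rnDeriv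
  let Φ : ℕ → Z → ℝ := fun n z => s n * w z - Real.exp (s n) + 1
  have hsup : ∀ z, ENNReal.ofReal (InformationTheory.klFun (w z)) ≤
      ⨆ n, ENNReal.ofReal (Φ n z) := by
    intro z
    refine le_of_forall_lt fun b hb => ?_
    obtain ⟨y, hy⟩ := exists_lt_mul_sub_exp (w := w z) ENNReal.toReal_nonneg
      (ENNReal.lt_ofReal_iff_toReal_lt hb.ne_top |>.1 hb)
    have hopen : IsOpen {y : ℝ | b.toReal < y * w z - Real.exp y + 1} :=
      isOpen_lt continuous_const (by fun_prop)
    obtain ⟨n, hn⟩ := (TopologicalSpace.denseRange_denseSeq ℝ).exists_mem_open hopen ⟨y, hy⟩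
    refine lt_iSup_iff.2 ⟨n + 1, ?_⟩
    exact (ENNReal.lt_ofReal_iff_toReal_lt hb.ne_top).2 hn
  rw [InformationTheory.klDiv_eq_lintegral_klFun_of_ac hac] at hlt
  obtain ⟨N, η, hη0, hη1, hη⟩ := exists_continuous_weights_of_lt_lintegral ρ (Φ := Φ)
    (fun n => ((hw.const_mul _).sub_const _).add_const _)
    (fun n => ((hwi.const_mul _).sub (integrable_const _)).add (integrable_const _))
    (fun z => by simp [Φ, s]) (hlt.trans_le (lintegral_mono hsup))
  let k : C(Z, ℝ) := ∑ n ∈ Finset.range (N + 1), s n • η n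
  have hk : ∀ z, k z = ∑ n ∈ Finset.range (N + 1), η n z * s n := fun z => by
    simp [k, ContinuousMap.sum_apply, mul_comm]
  have hle : ∫ z, ∑ n ∈ Finset.range (N + 1), η n z * Φ n z ∂ρ ≤
      ∫ z, (k z * w z - Real.exp (k z) + 1) ∂ρ := by
    refine integral_mono (integrable_finsetSum _ fun n _ => integrable_continuousMap_mul
      (((hwi.const_mul _).sub (integrable_const _)).add (integrable_const _)) _)
      (((integrable_continuousMap_mul hwi k).sub
        (integrable_exp_continuousMap ρ k)).add (integrable_const _)) fun z => ?_
    have hexp : Real.exp (k z) ≤ ∑ n ∈ Finset.range (N + 1), η n z * Real.exp (s n) := by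
      have := convexOn_exp.map_sum_le (t := Finset.range (N + 1)) (w := fun n => η n z) (p := s)
        (fun n _ => hη0 n z) (hη1 z) (fun _ _ => mem_univ _)
      simpa [hk] using this
    have : ∑ n ∈ Finset.range (N + 1), η n z * Φ n z =
        k z * w z - ∑ n ∈ Finset.range (N + 1), η n z * Real.exp (s n) + 1 := by
      rw [hk, ← hη1 z, Finset.sum_mul, ← Finset.sum_sub_distrib, ← Finset.sum_add_distrib]
      exact Finset.sum_congr rfl fun n _ => by simp only [Φ]; ring
    simp only [this]
    linarith
  have := h k
  rw [integral_eq_integral_rnDeriv_mul hac] at this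
  linarith

end

/-! ### The cost and its conjugate -/

section Cost

variable {X Y : Type*}
  [MetricSpace X] [CompactSpace X] [MeasurableSpace X] [BorelSpace X]
  [MetricSpace Y] [CompactSpace Y] [MeasurableSpace Y] [BorelSpace Y] [Nonempty Y]
  {c : X → ProbabilityMeasure Y → ℝ≥0∞} {K : Set C(Y, ℝ)}

theorem continuous_integral_continuousMap {Z : Type*} [MetricSpace Z] [CompactSpace Z]
    [MeasurableSpace Z] [BorelSpace Z] (k : C(Z, ℝ)) :
    Continuous fun p : ProbabilityMeasure Z => ∫ z, k z ∂(p : Measure Z) :=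
  ProbabilityMeasure.continuous_integral_boundedContinuousFunction
    (BoundedContinuousFunction.mkOfCompact k)

theorem integral_le_integral_add_norm_sub (p : ProbabilityMeasure Y) (γ γ' : C(Y, ℝ)) :
    ∫ y, γ y ∂(p : Measure Y) ≤ ∫ y, γ' y ∂(p : Measure Y) + ‖γ - γ'‖ := by
  have h : ∫ y, γ y ∂(p : Measure Y) ≤ ∫ y, (γ' y + ‖γ - γ'‖) ∂(p : Measure Y) := by
    refine integral_mono (integrable_continuousMap _ γ)
      ((integrable_continuousMap _ γ').add (integrable_const _)) fun y => ?_
    have := (le_abs_self _).trans ((γ - γ').norm_coe_le_norm y)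
    simp only [ContinuousMap.sub_apply] at this
    dsimp only
    linarith
  rwa [integral_add (integrable_continuousMap _ γ') (integrable_const _), integral_const,
    probReal_univ, one_smul] at h

theorem abs_integral_le_norm (p : ProbabilityMeasure Y) (γ : C(Y, ℝ)) :
    |∫ y, γ y ∂(p : Measure Y)| ≤ ‖γ‖ := by
  have h1 := integral_le_integral_add_norm_sub p γ 0
  have h2 := integral_le_integral_add_norm_sub p 0 γ
  simp only [sub_zero, zero_sub, norm_neg, ContinuousMap.zero_apply, integral_zero] at h1 h2
  exact abs_le.2 ⟨by linarith, by linarith⟩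

theorem continuous_integral_prod :
    Continuous fun z : ProbabilityMeasure Y × C(Y, ℝ) => ∫ y, z.2 y ∂(z.1 : Measure Y) := by
  rw [continuous_iff_continuousAt]
  rintro ⟨p₀, γ₀⟩
  rw [ContinuousAt, tendsto_iff_dist_tendsto_zero]
  have h1 : Filter.Tendsto (fun z : ProbabilityMeasure Y × C(Y, ℝ) => ‖z.2 - γ₀‖ +
      |∫ y, γ₀ y ∂(z.1 : Measure Y) - ∫ y, γ₀ y ∂(p₀ : Measure Y)|) (nhds (p₀, γ₀)) (nhds 0) := by
    have : Continuous fun z : ProbabilityMeasure Y × C(Y, ℝ) => ‖z.2 - γ₀‖ +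
      |∫ y, γ₀ y ∂(z.1 : Measure Y) - ∫ y, γ₀ y ∂(p₀ : Measure Y)| :=
      (continuous_snd.sub continuous_const).norm.add
        (((continuous_integral_continuousMap γ₀).comp continuous_fst).sub continuous_const).abs
    simpa using this.tendsto (p₀, γ₀)
  refine squeeze_zero (fun _ => dist_nonneg) (fun z => ?_) h1
  rw [Real.dist_eq]
  have h2 := integral_le_integral_add_norm_sub z.1 z.2 γ₀
  have h3 := integral_le_integral_add_norm_sub z.1 γ₀ z.2
  rw [norm_sub_rev] at h3
  refine abs_le.2 ⟨?_, ?_⟩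
  · linarith [neg_abs_le (∫ y, γ₀ y ∂(z.1 : Measure Y) - ∫ y, γ₀ y ∂(p₀ : Measure Y))]
  · linarith [le_abs_self (∫ y, γ₀ y ∂(z.1 : Measure Y) - ∫ y, γ₀ y ∂(p₀ : Measure Y))]

/-- The cost as a real number. -/
def costR (c : X → ProbabilityMeasure Y → ℝ≥0∞) (x : X) (p : ProbabilityMeasure Y) : ℝ :=
  (c x p).toReal

/-- The conjugate `c^*` of the cost as a real number. -/
def conjR (c : X → ProbabilityMeasure Y → ℝ≥0∞) (x : X) (γ : C(Y, ℝ)) : ℝ :=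
  (costConj c x γ).toReal

theorem costConj_le_norm (c : X → ProbabilityMeasure Y → ℝ≥0∞) (x : X) (γ : C(Y, ℝ)) :
    costConj c x γ ≤ (‖γ‖ : ℝ) := by
  refine iSup_le fun q => ?_
  have h1 : ((∫ y, γ y ∂(q : Measure Y) : ℝ) : EReal) ≤ (‖γ‖ : ℝ) :=
    EReal.coe_le_coe_iff.2 ((le_abs_self _).trans (abs_integral_le_norm q γ))
  exact (EReal.sub_le_sub h1 (EReal.coe_ennreal_nonneg _)).trans (by simp)

theorem integral_sub_le_costConj (x : X) (γ : C(Y, ℝ)) {p : ProbabilityMeasure Y}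
    (hp : c x p ≠ ⊤) :
    ((∫ y, γ y ∂(p : Measure Y) - costR c x p : ℝ) : EReal) ≤ costConj c x γ := by
  refine le_trans ?_ (le_iSup _ p)
  rw [EReal.coe_sub, costR, EReal.coe_ennreal_toReal hp]

theorem coe_conjR (hc : IsWeakCost c) (x : X) (γ : C(Y, ℝ)) :
    (conjR c x γ : EReal) = costConj c x γ := by
  obtain ⟨p, hp⟩ := hc.proper x
  refine EReal.coe_toReal (ne_top_of_le_ne_top (EReal.coe_ne_top _) (costConj_le_norm c x γ)) ?_
  exact ne_bot_of_le_ne_bot (EReal.coe_ne_bot _) (integral_sub_le_costConj x γ hp)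

theorem conjR_le_norm (hc : IsWeakCost c) (x : X) (γ : C(Y, ℝ)) : conjR c x γ ≤ ‖γ‖ := by
  rw [← EReal.coe_le_coe_iff, coe_conjR hc]
  exact costConj_le_norm c x γ

theorem IsDualSet.nonempty [Nonempty X] (hK : IsDualSet c K) : K.Nonempty := by
  by_contra h
  rw [not_nonempty_iff_eq_empty] at h
  have := hK.repr (Classical.arbitrary X) ⟨Measure.dirac (Classical.arbitrary Y), inferInstance⟩
  simp [h] at this

/-- A cost with a compact dual set has oscillation at most twice the norm of the dual set; in
particular it is everywhere finite. -/
theorem exists_cost_le (hc : IsWeakCost c) (hK : IsDualSet c K) :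
    ∃ R : ℝ, 0 ≤ R ∧ (∀ γ ∈ K, ‖γ‖ ≤ R) ∧
      ∀ x p q, c x q ≠ ⊤ → c x p ≤ ENNReal.ofReal (2 * R + costR c x q) := by
  obtain ⟨R, hR0, hR⟩ := hK.compact.isBounded.exists_pos_norm_le
  refine ⟨R, hR0.le, hR, fun x p q hq => ?_⟩
  rw [← EReal.coe_ennreal_le_coe_ennreal_iff, hK.repr x p]
  refine iSup₂_le fun γ hγ => ?_
  have h1 := integral_sub_le_costConj x γ hq
  rw [← coe_conjR hc, EReal.coe_le_coe_iff] at h1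
  rw [← coe_conjR hc, ← EReal.coe_sub, EReal.coe_ennreal_ofReal, EReal.coe_le_coe_iff]
  refine le_max_of_le_left ?_
  have h2 := abs_le.1 (abs_integral_le_norm q γ)
  have h3 := abs_le.1 (abs_integral_le_norm p γ)
  linarith [hR γ hγ]

theorem cost_ne_top (hc : IsWeakCost c) (hK : IsDualSet c K) (x : X) (p : ProbabilityMeasure Y) :
    c x p ≠ ⊤ := by
  obtain ⟨R, -, -, hR⟩ := exists_cost_le hc hK
  obtain ⟨q, hq⟩ := hc.proper x
  exact ne_top_of_le_ne_top ENNReal.ofReal_ne_top (hR x p q hq)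

theorem ofReal_costR (hc : IsWeakCost c) (hK : IsDualSet c K) (x : X) (p : ProbabilityMeasure Y) :
    ENNReal.ofReal (costR c x p) = c x p :=
  ENNReal.ofReal_toReal (cost_ne_top hc hK x p)

theorem costR_nonneg (x : X) (p : ProbabilityMeasure Y) : 0 ≤ costR c x p := ENNReal.toReal_nonneg

theorem exists_costR_le (hc : IsWeakCost c) (hK : IsDualSet c K) :
    ∃ R : ℝ, 0 ≤ R ∧ (∀ γ ∈ K, ‖γ‖ ≤ R) ∧ ∀ x p q, costR c x p ≤ 2 * R + costR c x q := by
  obtain ⟨R, hR0, hR, h⟩ := exists_cost_le hc hK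
  refine ⟨R, hR0, hR, fun x p q => ?_⟩
  have := h x p q (cost_ne_top hc hK x q)
  rwa [← ofReal_costR hc hK, ENNReal.ofReal_le_ofReal_iff
    (add_nonneg (by positivity) (costR_nonneg x q))] at this

/-- The Fenchel–Young inequality for the cost. -/
theorem integral_le_costR_add_conjR (hc : IsWeakCost c) (hK : IsDualSet c K) (x : X)
    (p : ProbabilityMeasure Y) (γ : C(Y, ℝ)) :
    ∫ y, γ y ∂(p : Measure Y) ≤ costR c x p + conjR c x γ := by
  have := integral_sub_le_costConj x γ (cost_ne_top hc hK x p)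
  rw [← coe_conjR hc, EReal.coe_le_coe_iff] at this
  linarith

theorem conjR_le (hc : IsWeakCost c) (hK : IsDualSet c K) {x : X} {γ : C(Y, ℝ)} {a : ℝ}
    (h : ∀ p : ProbabilityMeasure Y, ∫ y, γ y ∂(p : Measure Y) ≤ costR c x p + a) :
    conjR c x γ ≤ a := by
  rw [← EReal.coe_le_coe_iff, coe_conjR hc]
  refine iSup_le fun p => ?_
  rw [← EReal.coe_ennreal_toReal (cost_ne_top hc hK x p), ← EReal.coe_sub, EReal.coe_le_coe_iff]
  have := h p
  rw [costR] at this
  linarith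

theorem conjR_le_add_norm_sub (hc : IsWeakCost c) (hK : IsDualSet c K) (x : X) (γ γ' : C(Y, ℝ)) :
    conjR c x γ ≤ conjR c x γ' + ‖γ - γ'‖ :=
  conjR_le hc hK fun p => by
    linarith [integral_le_integral_add_norm_sub p γ γ', integral_le_costR_add_conjR hc hK x p γ']

theorem continuous_conjR (hc : IsWeakCost c) (hK : IsDualSet c K) (x : X) :
    Continuous (conjR c x) := by
  refine (LipschitzWith.of_dist_le_mul (K := 1) fun γ γ' => ?_).continuous
  rw [Real.dist_eq, NNReal.coe_one, one_mul, dist_eq_norm]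
  have h1 := conjR_le_add_norm_sub hc hK x γ γ'
  have h2 := conjR_le_add_norm_sub hc hK x γ' γ
  rw [norm_sub_rev] at h2
  exact abs_le.2 ⟨by linarith, by linarith⟩

theorem convexOn_conjR (hc : IsWeakCost c) (hK : IsDualSet c K) (x : X) :
    ConvexOn ℝ univ (conjR c x) := by
  refine ⟨convex_univ, fun γ _ γ' _ s t hs ht hst => conjR_le hc hK fun p => ?_⟩
  have h1 := mul_le_mul_of_nonneg_left (integral_le_costR_add_conjR hc hK x p γ) hs
  have h2 := mul_le_mul_of_nonneg_left (integral_le_costR_add_conjR hc hK x p γ') ht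
  have h3 : ∫ y, (s • γ + t • γ') y ∂(p : Measure Y) =
      s * ∫ y, γ y ∂(p : Measure Y) + t * ∫ y, γ' y ∂(p : Measure Y) := by
    simp only [ContinuousMap.add_apply, ContinuousMap.smul_apply, smul_eq_mul]
    rw [integral_add ((integrable_continuousMap _ γ).const_mul s)
      ((integrable_continuousMap _ γ').const_mul t), integral_const_mul, integral_const_mul]
  rw [h3, smul_eq_mul, smul_eq_mul]
  have h4 : s * costR c x p + t * costR c x p = costR c x p := by rw [← add_mul, hst, one_mul]
  linarith

theorem isLUB_costR (hc : IsWeakCost c) (hK : IsDualSet c K) (x : X) (p : ProbabilityMeasure Y) :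
    IsLUB ((fun γ : C(Y, ℝ) => ∫ y, γ y ∂(p : Measure Y) - conjR c x γ) '' K) (costR c x p) := by
  refine ⟨?_, fun b hb => ?_⟩
  · rintro _ ⟨γ, -, rfl⟩
    dsimp only
    linarith [integral_le_costR_add_conjR hc hK x p γ]
  · rw [← EReal.coe_le_coe_iff, costR, EReal.coe_ennreal_toReal (cost_ne_top hc hK x p),
      hK.repr x p]
    refine iSup₂_le fun γ hγ => ?_
    rw [← coe_conjR hc, ← EReal.coe_sub, EReal.coe_le_coe_iff]
    exact hb ⟨γ, hγ, rfl⟩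

theorem continuous_costR [Nonempty X] (hc : IsWeakCost c) (hK : IsDualSet c K) (x : X) :
    Continuous (costR c x) := by
  have h : costR c x = fun p => sSup ((fun (p : ProbabilityMeasure Y) (γ : C(Y, ℝ)) =>
      ∫ y, γ y ∂(p : Measure Y) - conjR c x γ) p '' K) :=
    funext fun p => ((isLUB_costR hc hK x p).csSup_eq (hK.nonempty.image _)).symm
  rw [h]
  refine hK.compact.continuous_sSup ?_
  exact continuous_integral_prod.sub ((continuous_conjR hc hK x).comp continuous_snd)

/-- A countable subset of the dual set already represents the cost. -/
theorem exists_seq_isLUB_costR [Nonempty X] (hc : IsWeakCost c) (hK : IsDualSet c K) :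
    ∃ γ : ℕ → C(Y, ℝ), (∀ n, γ n ∈ K) ∧ ∀ x (p : ProbabilityMeasure Y),
      IsLUB (range fun n => ∫ y, γ n y ∂(p : Measure Y) - conjR c x (γ n)) (costR c x p) := by
  have : CompactSpace K := isCompact_iff_compactSpace.1 hK.compact
  have : Nonempty K := hK.nonempty.to_subtype
  refine ⟨fun n => TopologicalSpace.denseSeq K n, fun n => Subtype.coe_prop _, fun x p => ?_⟩
  refine ⟨?_, fun b hb => (isLUB_costR hc hK x p).2 ?_⟩
  · rintro _ ⟨n, rfl⟩
    exact (isLUB_costR hc hK x p).1 ⟨_, Subtype.coe_prop _, rfl⟩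
  · rintro _ ⟨γ, hγ, rfl⟩
    have hcont : Continuous fun k : K => ∫ y, (k : C(Y, ℝ)) y ∂(p : Measure Y) - conjR c x k :=
      (continuous_integral_prod.comp (continuous_const.prodMk continuous_subtype_val)).sub
        ((continuous_conjR hc hK x).comp continuous_subtype_val)
    have hcl : IsClosed {k : K | ∫ y, (k : C(Y, ℝ)) y ∂(p : Measure Y) - conjR c x k ≤ b} :=
      isClosed_le hcont continuous_const
    have := (TopologicalSpace.denseRange_denseSeq K).induction_on (p := fun k : K =>
      ∫ y, (k : C(Y, ℝ)) y ∂(p : Measure Y) - conjR c x k ≤ b) ⟨γ, hγ⟩ hcl fun n => hb ⟨n, rfl⟩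
    exact this

theorem measurable_costR_left (hc : IsWeakCost c) (p : ProbabilityMeasure Y) :
    Measurable fun x => costR c x p := by
  borelize (X × ProbabilityMeasure Y)
  have h : Measurable fun x : X => (x, p) :=
    (by fun_prop : Continuous fun x : X => (x, p)).measurable
  exact (hc.borel.comp h).ennreal_toReal

/-- Since the cost is continuous in its second variable, a countable dense set of probability
measures suffices to compute `c^*`. -/
theorem measurable_conjR [Nonempty X] (hc : IsWeakCost c) (hK : IsDualSet c K) (β : C(X × Y, ℝ)) :
    Measurable fun x => conjR c x (β.curry x) := by
  let _ := TopologicalSpace.pseudoMetrizableSpacePseudoMetric (ProbabilityMeasure Y)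
  have : Nonempty (ProbabilityMeasure Y) :=
    ⟨⟨Measure.dirac (Classical.arbitrary Y), inferInstance⟩⟩
  let q := TopologicalSpace.denseSeq (ProbabilityMeasure Y)
  refine Measurable.isLUB (f := fun n x => ∫ y, β (x, y) ∂(q n : Measure Y) - costR c x (q n))
    (fun n => ?_) fun x => ?_
  · exact (β.continuous.stronglyMeasurable.integral_prod_right').measurable.sub
      (measurable_costR_left hc _)
  · refine ⟨?_, fun b hb => conjR_le hc hK fun p => ?_⟩
    · rintro _ ⟨n, rfl⟩
      have := integral_le_costR_add_conjR hc hK x (q n) (β.curry x)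
      simp only [ContinuousMap.curry_apply] at this
      linarith
    · have hcl : IsClosed {p : ProbabilityMeasure Y |
          ∫ y, β.curry x y ∂(p : Measure Y) ≤ costR c x p + b} :=
        isClosed_le (continuous_integral_continuousMap _)
          ((continuous_costR hc hK x).add continuous_const)
      refine (TopologicalSpace.denseRange_denseSeq _).induction_on
        (p := fun p : ProbabilityMeasure Y => ∫ y, β.curry x y ∂(p : Measure Y) ≤ costR c x p + b)
        p hcl fun n => ?_
      have := hb ⟨n, rfl⟩
      simp only [ContinuousMap.curry_apply]
      linarith

end Cost

/-! ### Measurability and integrability along a disintegration -/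

section Disintegration

variable {X Y : Type*}
  [MetricSpace X] [CompactSpace X] [MeasurableSpace X] [BorelSpace X]
  [MetricSpace Y] [CompactSpace Y] [MeasurableSpace Y] [BorelSpace Y] [Nonempty Y]
  {c : X → ProbabilityMeasure Y → ℝ≥0∞} {K : Set C(Y, ℝ)}

theorem measurable_integral_disint {d : ℕ} (π : ProbabilityMeasure (X × Y)) (k : C(X × Y, Vec d)) :
    Measurable fun x => ∫ y, k (x, y) ∂(disint π x : Measure Y) :=
  (k.continuous.stronglyMeasurable.integral_kernel_prod_right'
    (κ := (π : Measure (X × Y)).condKernel)).measurable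

theorem measurable_integral_disint_real (π : ProbabilityMeasure (X × Y)) (k : C(X × Y, ℝ)) :
    Measurable fun x => ∫ y, k (x, y) ∂(disint π x : Measure Y) :=
  (k.continuous.stronglyMeasurable.integral_kernel_prod_right'
    (κ := (π : Measure (X × Y)).condKernel)).measurable

theorem integral_integral_disint {μ : ProbabilityMeasure X} {π : ProbabilityMeasure (X × Y)}
    (hπ : (π : Measure (X × Y)).fst = (μ : Measure X)) (k : C(X × Y, ℝ)) :
    ∫ x, ∫ y, k (x, y) ∂(disint π x : Measure Y) ∂(μ : Measure X) =
      ∫ z, k z ∂(π : Measure (X × Y)) := by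
  rw [← hπ]
  exact Measure.integral_condKernel (integrable_continuousMap _ k)

theorem measurable_costR_disint [Nonempty X] (hc : IsWeakCost c) (hK : IsDualSet c K)
    (π : ProbabilityMeasure (X × Y)) : Measurable fun x => costR c x (disint π x) := by
  obtain ⟨γ, -, hγ⟩ := exists_seq_isLUB_costR hc hK
  refine Measurable.isLUB (f := fun n x => ∫ y, γ n y ∂(disint π x : Measure Y) - conjR c x (γ n))
    (fun n => ?_) fun x => hγ x _
  let β : C(X × Y, ℝ) := ⟨fun z => γ n z.2, by fun_prop⟩
  exact (measurable_integral_disint_real π β).sub (measurable_conjR hc hK β)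

/-- Finiteness of the transport cost for one plan gives it for all plans, because the oscillation of
the cost is bounded. -/
theorem integrable_costR_disint [Nonempty X] (hc : IsWeakCost c) (hK : IsDualSet c K)
    {μ : ProbabilityMeasure X} (hfin : ∃ π : ProbabilityMeasure (X × Y), weakCost μ c π < ⊤)
    (π : ProbabilityMeasure (X × Y)) :
    Integrable (fun x => costR c x (disint π x)) (μ : Measure X) := by
  obtain ⟨π₀, hπ₀⟩ := hfin
  have h0 : Integrable (fun x => costR c x (disint π₀ x)) (μ : Measure X) := by
    refine ⟨(measurable_costR_disint hc hK π₀).aestronglyMeasurable, ?_⟩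
    rw [hasFiniteIntegral_iff_ofReal (ae_of_all _ fun x => costR_nonneg x _)]
    simpa only [ofReal_costR hc hK, weakCost] using hπ₀
  obtain ⟨R, hR0, -, hR⟩ := exists_costR_le hc hK
  refine ((integrable_const (2 * R)).add h0).mono'
    (measurable_costR_disint hc hK π).aestronglyMeasurable (ae_of_all _ fun x => ?_)
  rw [Real.norm_eq_abs, abs_of_nonneg (costR_nonneg x _)]
  exact hR x _ _

theorem weakCost_eq_ofReal [Nonempty X] (hc : IsWeakCost c) (hK : IsDualSet c K)
    {μ : ProbabilityMeasure X} {π : ProbabilityMeasure (X × Y)}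
    (hint : Integrable (fun x => costR c x (disint π x)) (μ : Measure X)) :
    weakCost μ c π = ENNReal.ofReal (∫ x, costR c x (disint π x) ∂(μ : Measure X)) := by
  rw [ofReal_integral_eq_lintegral_ofReal hint (ae_of_all _ fun x => costR_nonneg x _)]
  simp only [ofReal_costR hc hK, weakCost]

theorem integrable_conjR [Nonempty X] (hc : IsWeakCost c) (hK : IsDualSet c K)
    {μ : ProbabilityMeasure X} (hfin : ∃ π : ProbabilityMeasure (X × Y), weakCost μ c π < ⊤)
    (β : C(X × Y, ℝ)) : Integrable (fun x => conjR c x (β.curry x)) (μ : Measure X) := by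
  obtain ⟨π₀, hπ₀⟩ := hfin
  have h0 := integrable_costR_disint hc hK ⟨π₀, hπ₀⟩ π₀
  refine ((integrable_const ‖β.curry‖).add h0).mono' (measurable_conjR hc hK β).aestronglyMeasurable
    (ae_of_all _ fun x => ?_)
  have h1 := conjR_le_norm hc x (β.curry x)
  have h2 := integral_le_costR_add_conjR hc hK x (disint π₀ x) (β.curry x)
  have h3 := abs_le.1 (abs_integral_le_norm (disint π₀ x) (β.curry x))
  have h4 := β.curry.norm_coe_le_norm x
  have h5 := costR_nonneg (c := c) x (disint π₀ x)
  change |conjR c x (β.curry x)| ≤ ‖β.curry‖ + costR c x (disint π₀ x)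
  exact abs_le.2 ⟨by linarith, by linarith⟩

end Disintegration

/-! ### Tangent planes of a convex function -/

section Theta

variable {X Y : Type*} [MetricSpace X] [CompactSpace X] [MetricSpace Y] [CompactSpace Y] {M : ℕ}
  {θ : Vec M → ℝ} (f : C(X × Y, Vec M))

/-- The best Lipschitz constant is itself a Lipschitz constant. -/
theorem lipschitzOnWith_lipConst (hθ : ConvexOn ℝ univ θ) :
    LipschitzOnWith (lipConst θ f) θ (Metric.ball 0 (‖f‖ + 1)) := by
  have hne : {L : ℝ≥0 | LipschitzOnWith L θ (Metric.ball 0 (‖f‖ + 1))}.Nonempty := by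
    have hloc : LocallyLipschitzOn (Metric.closedBall 0 (‖f‖ + 1)) θ :=
      (hθ.locallyLipschitzOn isOpen_univ).mono (subset_univ _)
    obtain ⟨L, hL⟩ := hloc.exists_lipschitzOnWith_of_compact (isCompact_closedBall _ _)
    exact ⟨L, hL.mono Metric.ball_subset_closedBall⟩
  have hcl : IsClosed {L : ℝ≥0 | LipschitzOnWith L θ (Metric.ball 0 (‖f‖ + 1))} := by
    simp only [lipschitzOnWith_iff_dist_le_mul, ofPred_forall]
    exact isClosed_iInter fun x => isClosed_iInter fun _ => isClosed_iInter fun y =>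
      isClosed_iInter fun _ => isClosed_le continuous_const (by fun_prop)
  exact hcl.csInf_mem hne (OrderBot.bddBelow _)

/-- The slopes `v` of norm at most `C(θ, f)` at which `θ^*` is bounded by a fixed constant, large
enough for the subgradients of `θ` on the ball of radius `‖f‖_∞ + 1` to be among them. -/
def slopeSet (θ : Vec M → ℝ) (f : C(X × Y, Vec M)) : Set (Vec M) :=
  {v | ‖v‖ ≤ lipConst θ f ∧ ∀ u, inner ℝ v u - θ u ≤ lipConst θ f * (‖f‖ + 1)}

/-- The Legendre transform as a real number. -/
def legR (θ : Vec M → ℝ) (v : Vec M) : ℝ := (legendre θ v).toReal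

theorem legendre_ne_bot (θ : Vec M → ℝ) (v : Vec M) : legendre θ v ≠ ⊥ :=
  ne_bot_of_le_ne_bot (EReal.coe_ne_bot _)
    (le_iSup (fun u : Vec M => ((inner ℝ v u - θ u : ℝ) : EReal)) 0)

theorem measurable_legendre (θ : Vec M → ℝ) : Measurable (legendre θ) :=
  (lowerSemicontinuous_iSup fun u => Continuous.lowerSemicontinuous
    (continuous_coe_real_ereal.comp (by fun_prop))).measurable

theorem inner_sub_le_legR {v : Vec M} (hv : legendre θ v ≠ ⊤) (u : Vec M) :
    inner ℝ v u - θ u ≤ legR θ v := by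
  rw [← EReal.coe_le_coe_iff, legR, EReal.coe_toReal hv (legendre_ne_bot θ v)]
  exact le_iSup (fun u : Vec M => ((inner ℝ v u - θ u : ℝ) : EReal)) u

theorem legendre_ne_top {v : Vec M} {a : ℝ} (h : ∀ u, inner ℝ v u - θ u ≤ a) :
    legendre θ v ≠ ⊤ :=
  ne_top_of_le_ne_top (EReal.coe_ne_top a) (iSup_le fun u => EReal.coe_le_coe_iff.2 (h u))

theorem legR_le {v : Vec M} {a : ℝ} (h : ∀ u, inner ℝ v u - θ u ≤ a) : legR θ v ≤ a := by
  rw [← EReal.coe_le_coe_iff, legR, EReal.coe_toReal (legendre_ne_top h) (legendre_ne_bot θ v)]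
  exact iSup_le fun u => EReal.coe_le_coe_iff.2 (h u)

variable {f}

theorem legendre_ne_top_of_mem {v : Vec M} (hv : v ∈ slopeSet θ f) : legendre θ v ≠ ⊤ :=
  legendre_ne_top hv.2

theorem convex_slopeSet : Convex ℝ (slopeSet θ f) := by
  rintro v ⟨hv1, hv2⟩ w ⟨hw1, hw2⟩ s t hs ht hst
  refine ⟨?_, fun u => ?_⟩
  · calc ‖s • v + t • w‖ ≤ s * ‖v‖ + t * ‖w‖ := by
          refine (norm_add_le _ _).trans ?_
          rw [norm_smul, norm_smul, Real.norm_of_nonneg hs, Real.norm_of_nonneg ht]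
      _ ≤ s * lipConst θ f + t * lipConst θ f := by gcongr
      _ = lipConst θ f := by rw [← add_mul, hst, one_mul]
  · have h1 := mul_le_mul_of_nonneg_left (hv2 u) hs
    have h2 := mul_le_mul_of_nonneg_left (hw2 u) ht
    rw [inner_add_left, real_inner_smul_left, real_inner_smul_left]
    obtain rfl : s = 1 - t := by linarith
    linarith

theorem convexOn_legR : ConvexOn ℝ (slopeSet θ f) (legR θ) := by
  refine ⟨convex_slopeSet, fun v hv w hw s t hs ht hst => legR_le fun u => ?_⟩
  have h1 := mul_le_mul_of_nonneg_left (inner_sub_le_legR (legendre_ne_top_of_mem hv) u) hs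
  have h2 := mul_le_mul_of_nonneg_left (inner_sub_le_legR (legendre_ne_top_of_mem hw) u) ht
  rw [inner_add_left, real_inner_smul_left, real_inner_smul_left, smul_eq_mul, smul_eq_mul]
  obtain rfl : s = 1 - t := by linarith
  linarith

/-- On the ball of radius `‖f‖_∞` the function `θ` is the supremum of countably many of its tangent
planes, all of them with slopes bounded by the Lipschitz constant. -/
theorem exists_seq_isLUB_theta (hθ : ConvexOn ℝ univ θ) (hθ0 : ∀ u, 0 ≤ θ u) :
    ∃ v : ℕ → Vec M, (∀ n, v n ∈ slopeSet θ f) ∧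
      ∀ u : Vec M, ‖u‖ ≤ ‖f‖ → IsLUB (range fun n => inner ℝ (v n) u - legR θ (v n)) (θ u) := by
  have hL := lipschitzOnWith_lipConst f hθ
  set L := lipConst θ f with hLdef
  set B : Set (Vec M) := Metric.ball 0 (‖f‖ + 1)
  have hB : IsOpen B := Metric.isOpen_ball
  have : Nonempty B := ⟨⟨0, Metric.mem_ball_self (by positivity)⟩⟩
  let w : ℕ → Vec M := fun n => TopologicalSpace.denseSeq B n
  have hw : ∀ n, w n ∈ B := fun n => Subtype.coe_prop _
  choose v hv using fun n => exists_subgradient hθ (w n)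
  have hnorm : ∀ n, ‖v n‖ ≤ L := by
    intro n
    by_contra! hlt
    have hpos : 0 < ‖v n‖ := (NNReal.coe_nonneg L).trans_lt hlt
    have hev : ∀ᶠ t : ℝ in nhdsWithin 0 (Ioi 0), w n + t • v n ∈ B := by
      have hcont : Continuous fun t : ℝ => w n + t • v n := by fun_prop
      exact ((hcont.tendsto 0).mono_left nhdsWithin_le_nhds).eventually
        (hB.mem_nhds (by simpa using hw n))
    obtain ⟨t, htB, ht⟩ := (hev.and self_mem_nhdsWithin).exists
    have ht : 0 < t := ht
    have h1 := hv n (w n + t • v n)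
    rw [add_sub_cancel_left, real_inner_smul_right, real_inner_self_eq_norm_sq] at h1
    have h2 := (le_abs_self _).trans (hL.dist_le_mul _ htB _ (hw n))
    rw [dist_eq_norm, add_sub_cancel_left, norm_smul, Real.norm_of_nonneg ht.le] at h2
    nlinarith [mul_lt_mul_of_pos_right hlt (mul_pos ht hpos)]
  have hle : ∀ n u, inner ℝ (v n) u - θ u ≤ inner ℝ (v n) (w n) - θ (w n) := fun n u => by
    have := hv n u
    rw [inner_sub_right] at this
    linarith
  have hmem : ∀ n, v n ∈ slopeSet θ f := fun n => ⟨hnorm n, fun u => by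
    refine (hle n u).trans ?_
    have h1 := real_inner_le_norm (v n) (w n)
    have h2 : ‖v n‖ * ‖w n‖ ≤ L * (‖f‖ + 1) :=
      mul_le_mul (hnorm n) (mem_ball_zero_iff.1 (hw n)).le (norm_nonneg _) (NNReal.coe_nonneg _)
    linarith [hθ0 (w n)]⟩
  refine ⟨v, hmem, fun u hu => ⟨?_, fun b hb => ?_⟩⟩
  · rintro _ ⟨n, rfl⟩
    dsimp only
    linarith [inner_sub_le_legR (legendre_ne_top_of_mem (hmem n)) u]
  · have huB : u ∈ B := by rw [mem_ball_zero_iff]; linarith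
    have key : ∀ n, θ u ≤ b + 2 * L * ‖u - w n‖ := by
      intro n
      have h1 := hb ⟨n, rfl⟩
      have h2 := legR_le (hle n)
      have h3 := (le_abs_self _).trans (hL.dist_le_mul _ huB _ (hw n))
      have h4 := neg_abs_le (inner ℝ (v n) (u - w n))
      have h5 := abs_real_inner_le_norm (v n) (u - w n)
      have h6 := mul_le_mul_of_nonneg_right (hnorm n) (norm_nonneg (u - w n))
      rw [dist_eq_norm] at h3
      rw [inner_sub_right] at h4 h5
      dsimp only at h1
      linarith
    have hcl : IsClosed {w : B | θ u ≤ b + 2 * L * ‖u - w‖} :=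
      isClosed_le continuous_const (by fun_prop)
    have := (TopologicalSpace.denseRange_denseSeq B).induction_on
      (p := fun w : B => θ u ≤ b + 2 * L * ‖u - w‖) ⟨u, huB⟩ hcl key
    simpa using this

end Theta

/-! ### Plans, conditional means and weak duality -/

section Plans

variable {X Y : Type*}
  [MetricSpace X] [CompactSpace X] [MeasurableSpace X] [BorelSpace X]
  [MetricSpace Y] [CompactSpace Y] [MeasurableSpace Y] [BorelSpace Y] [Nonempty Y]
  {M N : ℕ} {c : X → ProbabilityMeasure Y → ℝ≥0∞} {K : Set C(Y, ℝ)}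
  {μ : ProbabilityMeasure X} {ν : ProbabilityMeasure Y}
  {θ : Vec M → ℝ} {f : C(X × Y, Vec M)} {g : C(X × Y, Vec N)}

/-- The conditional mean `∫ k(x, y) dπ_x(y)`. -/
def condMean {d : ℕ} (π : ProbabilityMeasure (X × Y)) (k : C(X × Y, Vec d)) (x : X) : Vec d :=
  ∫ y, k (x, y) ∂(disint π x : Measure Y)

theorem norm_condMean_le {d : ℕ} (π : ProbabilityMeasure (X × Y)) (k : C(X × Y, Vec d)) (x : X) :
    ‖condMean π k x‖ ≤ ‖k‖ := by
  have := norm_integral_le_of_norm_le_const (μ := (disint π x : Measure Y))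
    (ae_of_all _ fun y => k.norm_coe_le_norm (x, y))
  simpa [condMean] using this

theorem measurable_condMean {d : ℕ} (π : ProbabilityMeasure (X × Y)) (k : C(X × Y, Vec d)) :
    Measurable (condMean π k) := measurable_integral_disint π k

theorem integrable_condMean {d : ℕ} (π : ProbabilityMeasure (X × Y)) (k : C(X × Y, Vec d)) :
    Integrable (condMean π k) (μ : Measure X) :=
  (integrable_const ‖k‖).mono' (measurable_condMean π k).aestronglyMeasurable
    (ae_of_all _ fun x => norm_condMean_le π k x)

theorem integrable_inner_condMean {d : ℕ} (π : ProbabilityMeasure (X × Y)) (k : C(X × Y, Vec d))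
    (l : C(X, Vec d)) : Integrable (fun x => inner ℝ (l x) (condMean π k x)) (μ : Measure X) := by
  refine (integrable_const (‖l‖ * ‖k‖)).mono'
    (l.continuous.measurable.inner (measurable_condMean π k)).aestronglyMeasurable
    (ae_of_all _ fun x => (norm_inner_le_norm _ _).trans ?_)
  exact mul_le_mul (l.norm_coe_le_norm x) (norm_condMean_le π k x) (norm_nonneg _) (norm_nonneg _)

theorem integral_inner_eq {d : ℕ} {π : ProbabilityMeasure (X × Y)}
    (hπ : (π : Measure (X × Y)).fst = (μ : Measure X)) (k : C(X × Y, Vec d)) (l : C(X, Vec d)) :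
    ∫ z, inner ℝ (l z.1) (k z) ∂(π : Measure (X × Y)) =
      ∫ x, inner ℝ (l x) (condMean π k x) ∂(μ : Measure X) := by
  let k' : C(X × Y, ℝ) := ⟨fun z => inner ℝ (l z.1) (k z), by fun_prop⟩
  rw [show ∫ z, inner ℝ (l z.1) (k z) ∂(π : Measure (X × Y)) = ∫ z, k' z ∂(π : Measure (X × Y))
    from rfl, ← integral_integral_disint hπ]
  refine integral_congr_ae (ae_of_all _ fun x => ?_)
  have hk : Integrable (fun y => k (x, y)) (disint π x : Measure Y) :=
    integrable_continuousMap _ ⟨fun y => k (x, y), by fun_prop⟩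
  exact integral_inner hk (l x)

theorem integrable_theta_condMean (hθ : ConvexOn ℝ univ θ) (hθ0 : ∀ u, 0 ≤ θ u)
    (f : C(X × Y, Vec M)) (π : ProbabilityMeasure (X × Y)) :
    Integrable (fun x => θ (condMean π f x)) (μ : Measure X) := by
  have hcont : Continuous θ := by rw [← continuousOn_univ]; exact hθ.continuousOn isOpen_univ
  refine (integrable_const (θ 0 + lipConst θ f * ‖f‖)).mono'
    (hcont.measurable.comp (measurable_condMean π f)).aestronglyMeasurable
    (ae_of_all _ fun x => ?_)
  have hx := norm_condMean_le π f x
  have h1 := (lipschitzOnWith_lipConst f hθ).dist_le_mul (condMean π f x)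
    (mem_ball_zero_iff.2 (by linarith)) 0 (Metric.mem_ball_self (by positivity))
  rw [dist_zero_right, Real.dist_eq] at h1
  have h2 := mul_le_mul_of_nonneg_left hx (NNReal.coe_nonneg (lipConst θ f))
  rw [Real.norm_eq_abs, abs_of_nonneg (hθ0 _)]
  linarith [le_abs_self (θ (condMean π f x) - θ 0)]

/-- The functional `J` as a real number. -/
def realJ (μ : ProbabilityMeasure X) (c : X → ProbabilityMeasure Y → ℝ≥0∞) (θ : Vec M → ℝ)
    (f : C(X × Y, Vec M)) (π : ProbabilityMeasure (X × Y)) : ℝ :=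
  ∫ x, costR c x (disint π x) ∂(μ : Measure X) + ∫ x, θ (condMean π f x) ∂(μ : Measure X)

theorem realJ_nonneg (hθ0 : ∀ u, 0 ≤ θ u) (π : ProbabilityMeasure (X × Y)) :
    0 ≤ realJ μ c θ f π :=
  add_nonneg (integral_nonneg fun x => costR_nonneg x _) (integral_nonneg fun _ => hθ0 _)

theorem primalJ_eq_ofReal [Nonempty X] (hθ : ConvexOn ℝ univ θ) (hθ0 : ∀ u, 0 ≤ θ u)
    (hc : IsWeakCost c) (hK : IsDualSet c K)
    (hfin : ∃ π : ProbabilityMeasure (X × Y), weakCost μ c π < ⊤)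
    (π : ProbabilityMeasure (X × Y)) :
    primalJ μ c θ f π = ENNReal.ofReal (realJ μ c θ f π) := by
  rw [realJ, ENNReal.ofReal_add (integral_nonneg fun x => costR_nonneg x _)
    (integral_nonneg fun x => hθ0 _), primalJ,
    weakCost_eq_ofReal hc hK (integrable_costR_disint hc hK hfin π),
    ofReal_integral_eq_lintegral_ofReal (integrable_theta_condMean hθ hθ0 f π)
      (ae_of_all _ fun x => hθ0 _)]
  rfl

theorem integral_comp_fst {π : ProbabilityMeasure (X × Y)}
    (hπ : (π : Measure (X × Y)).fst = (μ : Measure X)) (φ : C(X, ℝ)) :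
    ∫ z, φ z.1 ∂(π : Measure (X × Y)) = ∫ x, φ x ∂(μ : Measure X) := by
  rw [← hπ, Measure.fst, integral_map measurable_fst.aemeasurable
    φ.continuous.aestronglyMeasurable]

theorem integral_comp_snd {π : ProbabilityMeasure (X × Y)}
    (hπ : (π : Measure (X × Y)).snd = (ν : Measure Y)) (ψ : C(Y, ℝ)) :
    ∫ z, ψ z.2 ∂(π : Measure (X × Y)) = ∫ y, ψ y ∂(ν : Measure Y) := by
  rw [← hπ, Measure.snd, integral_map measurable_snd.aemeasurable
    ψ.continuous.aestronglyMeasurable]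

theorem integral_Lam (π : ProbabilityMeasure (X × Y)) (φ : C(X, ℝ)) (ψ : C(Y, ℝ))
    (l : C(X, Vec M)) (α : C(X, Vec N)) (β : C(X × Y, ℝ)) :
    ∫ z, Lam f g (φ, ψ, l, α, β) z ∂(π : Measure (X × Y)) =
      ∫ z, β z ∂(π : Measure (X × Y)) + ∫ z, inner ℝ (l z.1) (f z) ∂(π : Measure (X × Y)) +
        ∫ z, inner ℝ (α z.1) (g z) ∂(π : Measure (X × Y)) -
        ∫ z, φ z.1 ∂(π : Measure (X × Y)) - ∫ z, ψ z.2 ∂(π : Measure (X × Y)) := by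
  have h1 := integrable_continuousMap (π : Measure (X × Y)) β
  have h2 := integrable_continuousMap (π : Measure (X × Y))
    ⟨fun z => inner ℝ (l z.1) (f z), by fun_prop⟩
  have h3 := integrable_continuousMap (π : Measure (X × Y))
    ⟨fun z => inner ℝ (α z.1) (g z), by fun_prop⟩
  have h4 := integrable_continuousMap (π : Measure (X × Y)) ⟨fun z => φ z.1, by fun_prop⟩
  have h5 := integrable_continuousMap (π : Measure (X × Y)) ⟨fun z => ψ z.2, by fun_prop⟩
  refine (integral_sub (((h1.add h2).add h3).sub h4) h5).trans ?_
  congr 1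
  refine (integral_sub ((h1.add h2).add h3) h4).trans ?_
  congr 1
  refine (integral_add (h1.add h2) h3).trans ?_
  congr 1
  exact integral_add h1 h2

/-- The dual functional never takes the value `-∞`; where it is finite, testing with any admissible
plan bounds it from below. -/
theorem dualF_eq_top_or_exists [Nonempty X] (hθ : ConvexOn ℝ univ θ) (hθ0 : ∀ u, 0 ≤ θ u)
    (hc : IsWeakCost c) (hK : IsDualSet c K)
    (hfin : ∃ π : ProbabilityMeasure (X × Y), weakCost μ c π < ⊤)
    (g : C(X × Y, Vec N)) (ξ : DualSpace X Y M N) :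
    dualF μ ν c θ K ξ = ⊤ ∨ ∃ F : ℝ, dualF μ ν c θ K ξ = F ∧ ∀ π ∈ momentCouplings μ ν g,
      ∫ z, Lam f g ξ z ∂(π : Measure (X × Y)) - F ≤ realJ μ c θ f π := by
  obtain ⟨φ, ψ, l, α, β⟩ := ξ
  by_cases hβ : ∀ x, β.curry x ∈ K
  swap
  · exact Or.inl (if_neg hβ)
  set h : X → EReal := fun x => costConj c x (β.curry x) + legendre θ (l x) with hdef
  have hF : dualF μ ν c θ K (φ, ψ, l, α, β) = extIntegral (μ : Measure X) h
      - ((∫ x, φ x ∂(μ : Measure X) : ℝ) : EReal) - ((∫ y, ψ y ∂(ν : Measure Y) : ℝ) : EReal) :=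
    if_pos hβ
  by_cases htop : extIntegral (μ : Measure X) h = ⊤
  · left
    rw [hF, htop, EReal.top_sub_coe, EReal.top_sub_coe]
  right
  have hh : ∀ x, h x = (conjR c x (β.curry x) : EReal) + legendre θ (l x) := fun x => by
    rw [coe_conjR hc]
  have hcint := integrable_conjR hc hK hfin β
  have hmeas : Measurable h := by
    have : h = fun x => (conjR c x (β.curry x) : EReal) + legendre θ (l x) := funext hh
    rw [this]
    exact (measurable_conjR hc hK β).coe_real_ereal.add
      ((measurable_legendre θ).comp l.continuous.measurable)
  have hbot : ∀ x, h x ≠ ⊥ := fun x => by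
    rw [hh, Ne, EReal.add_eq_bot_iff, not_or]
    exact ⟨EReal.coe_ne_bot _, legendre_ne_bot θ _⟩
  have hneg : ∫⁻ x, (-h x).toENNReal ∂(μ : Measure X) ≠ ⊤ := by
    have hlow : ∀ x, ((conjR c x (β.curry x) - θ 0 : ℝ) : EReal) ≤ h x := fun x => by
      rw [hh, sub_eq_add_neg, EReal.coe_add]
      gcongr
      refine le_trans ?_ (le_iSup (fun u : Vec M => ((inner ℝ (l x) u - θ u : ℝ) : EReal)) 0)
      simp
    refine ne_top_of_le_ne_top
      (b := ∫⁻ x, ENNReal.ofReal ‖conjR c x (β.curry x) - θ 0‖ ∂(μ : Measure X)) ?_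
      (lintegral_mono fun x => ?_)
    · exact ((hasFiniteIntegral_iff_norm _).1 (hcint.sub (integrable_const (θ 0))).2).ne
    · refine (EReal.toENNReal_le_toENNReal (EReal.neg_le_neg_iff.2 (hlow x))).trans ?_
      rw [← EReal.coe_neg, EReal.toENNReal_of_ne_top (EReal.coe_ne_top _), EReal.toReal_coe]
      exact ENNReal.ofReal_le_ofReal (neg_le_abs _)
  obtain ⟨hint, hae⟩ := integrable_toReal_of_extIntegral_ne_top hmeas hbot hneg htop
  refine ⟨∫ x, (h x).toReal ∂(μ : Measure X) - ∫ x, φ x ∂(μ : Measure X) -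
    ∫ y, ψ y ∂(ν : Measure Y), ?_, fun π hπ => ?_⟩
  · rw [hF, extIntegral_eq_integral hint hae]
    norm_cast
  · obtain ⟨⟨hfst, hsnd⟩, hmom⟩ := hπ
    have hα : ∫ x, inner ℝ (α x) (condMean π g x) ∂(μ : Measure X) = 0 := by
      rw [← integral_zero X ℝ (μ := (μ : Measure X))]
      refine integral_congr_ae ?_
      filter_upwards [hmom] with x hx
      rw [condMean, hx, inner_zero_right]
    rw [integral_Lam, integral_inner_eq hfst, integral_inner_eq hfst, hα,
      integral_comp_fst hfst, integral_comp_snd hsnd, ← integral_integral_disint hfst]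
    have hβi : Integrable (fun x => ∫ y, β (x, y) ∂(disint π x : Measure Y)) (μ : Measure X) := by
      refine (integrable_const ‖β‖).mono' (measurable_integral_disint_real π β).aestronglyMeasurable
        (ae_of_all _ fun x => ?_)
      simpa using norm_integral_le_of_norm_le_const (μ := (disint π x : Measure Y))
        (ae_of_all _ fun y => β.norm_coe_le_norm (x, y))
    have hli := integrable_inner_condMean (μ := μ) π f l
    have hci := integrable_costR_disint hc hK hfin π
    have hti := integrable_theta_condMean (μ := μ) hθ hθ0 f π
    have hmono : ∫ x, (∫ y, β (x, y) ∂(disint π x : Measure Y) + inner ℝ (l x) (condMean π f x))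
        ∂(μ : Measure X) ≤ ∫ x, ((costR c x (disint π x) + θ (condMean π f x)) + (h x).toReal)
        ∂(μ : Measure X) := by
      refine integral_mono_ae (hβi.add hli) ((hci.add hti).add hint) ?_
      filter_upwards [hae] with x hx
      have hleg : legendre θ (l x) ≠ ⊤ := by
        intro htop
        rw [hh, htop, EReal.coe_add_top] at hx
        exact EReal.coe_ne_top _ hx.symm
      have hx' : (h x).toReal = conjR c x (β.curry x) + legR θ (l x) := by
        rw [hh, EReal.toReal_add (EReal.coe_ne_top _) (EReal.coe_ne_bot _) hleg
          (legendre_ne_bot θ _)]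
        rfl
      have h1 := integral_le_costR_add_conjR hc hK x (disint π x) (β.curry x)
      have h2 := inner_sub_le_legR hleg (condMean π f x)
      simp only [ContinuousMap.curry_apply] at h1
      rw [hx']
      linarith
    have e1 : ∫ x, (∫ y, β (x, y) ∂(disint π x : Measure Y) + inner ℝ (l x) (condMean π f x))
        ∂(μ : Measure X) = _ := integral_add hβi hli
    have e2 : ∫ x, ((costR c x (disint π x) + θ (condMean π f x)) + (h x).toReal)
        ∂(μ : Measure X) = _ := integral_add (hci.add hti) hint
    have e3 : ∫ x, (costR c x (disint π x) + θ (condMean π f x)) ∂(μ : Measure X) = _ :=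
      integral_add hci hti
    rw [e1, e2, e3] at hmono
    rw [realJ]
    linarith

theorem integrable_legR (θ : Vec M → ℝ) {l : C(X, Vec M)} (hl : ∀ x, l x ∈ slopeSet θ f) :
    Integrable (fun x => legR θ (l x)) (μ : Measure X) := by
  have hm : Measurable fun x => legR θ (l x) :=
    ((measurable_legendre θ).comp l.continuous.measurable).ereal_toReal
  refine (integrable_const (|θ 0| + lipConst θ f * (‖f‖ + 1))).mono' hm.aestronglyMeasurable
    (ae_of_all _ fun x => ?_)
  have h1 := legR_le (hl x).2
  have h2 := inner_sub_le_legR (legendre_ne_top_of_mem (hl x)) 0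
  rw [inner_zero_right] at h2
  have h3 : 0 ≤ lipConst θ f * (‖f‖ + 1) := by positivity
  exact abs_le.2 ⟨by linarith [le_abs_self (θ 0)], by linarith [abs_nonneg (θ 0)]⟩

/-- On dual variables with uniformly bounded slopes the dual functional is real-valued. -/
theorem dualF_eq_coe [Nonempty X] (hc : IsWeakCost c) (hK : IsDualSet c K)
    (hfin : ∃ π : ProbabilityMeasure (X × Y), weakCost μ c π < ⊤)
    (φ : C(X, ℝ)) (ψ : C(Y, ℝ)) (α : C(X, Vec N)) {l : C(X, Vec M)}
    (hl : ∀ x, l x ∈ slopeSet θ f) {β : C(X × Y, ℝ)} (hβ : ∀ x, β.curry x ∈ K) :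
    dualF μ ν c θ K (φ, ψ, l, α, β) =
      ((∫ x, conjR c x (β.curry x) ∂(μ : Measure X) + ∫ x, legR θ (l x) ∂(μ : Measure X)
        - ∫ x, φ x ∂(μ : Measure X) - ∫ y, ψ y ∂(ν : Measure Y) : ℝ) : EReal) := by
  have hF : dualF μ ν c θ K (φ, ψ, l, α, β) =
      extIntegral (μ : Measure X) (fun x => costConj c x (β.curry x) + legendre θ (l x))
      - ((∫ x, φ x ∂(μ : Measure X) : ℝ) : EReal) - ((∫ y, ψ y ∂(ν : Measure Y) : ℝ) : EReal) :=
    if_pos hβ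
  have hci := integrable_conjR hc hK hfin β
  have hli := integrable_legR (μ := μ) θ hl
  rw [hF, extIntegral_eq_integral (hci.add hli), Pi.add_def, integral_add hci hli]
  · norm_cast
  · refine ae_of_all _ fun x => ?_
    rw [Pi.add_apply, EReal.coe_add, coe_conjR hc, legR,
      EReal.coe_toReal (legendre_ne_top_of_mem (hl x)) (legendre_ne_bot θ _)]

/-- The integral of the cost is a supremum over continuous selections of the dual set. -/
theorem exists_continuous_integral_cost_le [Nonempty X] (hc : IsWeakCost c) (hK : IsDualSet c K)
    (hfin : ∃ π : ProbabilityMeasure (X × Y), weakCost μ c π < ⊤)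
    {π : ProbabilityMeasure (X × Y)} (hπ : (π : Measure (X × Y)).fst = (μ : Measure X)) {δ : ℝ}
    (hδ : 0 < δ) :
    ∃ β : C(X × Y, ℝ), (∀ x, β.curry x ∈ K) ∧
      ∫ x, costR c x (disint π x) ∂(μ : Measure X) - δ ≤
        ∫ z, β z ∂(π : Measure (X × Y)) - ∫ x, conjR c x (β.curry x) ∂(μ : Measure X) := by
  obtain ⟨γ, hγ, hlub⟩ := exists_seq_isLUB_costR hc hK
  let b : ℕ → C(X × Y, ℝ) := fun n => ⟨fun z => γ n z.2, by fun_prop⟩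
  have hint : ∀ β : C(X × Y, ℝ),
      Integrable (fun x => ∫ y, β (x, y) ∂(disint π x : Measure Y)) (μ : Measure X) := fun β => by
    refine (integrable_const ‖β‖).mono' (measurable_integral_disint_real π β).aestronglyMeasurable
      (ae_of_all _ fun x => ?_)
    simpa using norm_integral_le_of_norm_le_const (μ := (disint π x : Measure Y))
      (ae_of_all _ fun y => β.norm_coe_le_norm (x, y))
  obtain ⟨n₀, η, hη0, hη1, hη⟩ := exists_continuous_weights_of_isLUB (μ : Measure X)
    (Φ := fun n x => ∫ y, γ n y ∂(disint π x : Measure Y) - conjR c x (γ n))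
    (fun n => (measurable_integral_disint_real π (b n)).sub (measurable_conjR hc hK (b n)))
    (fun n => (hint (b n)).sub (integrable_conjR hc hK hfin (b n)))
    (integrable_costR_disint hc hK hfin π) (fun x => hlub x _) hδ
  let β : C(X × Y, ℝ) :=
    ⟨fun z => ∑ n ∈ Finset.range (n₀ + 1), η n z.1 * γ n z.2, by fun_prop⟩
  have hβ : ∀ x, β.curry x = ∑ n ∈ Finset.range (n₀ + 1), η n x • γ n := fun x => by
    ext y; simp [β, ContinuousMap.sum_apply]
  refine ⟨β, fun x => ?_, hη.trans ?_⟩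
  · rw [hβ]
    exact hK.convex.sum_mem (fun n _ => hη0 n x) (hη1 x) fun n _ => hγ n
  · rw [← integral_integral_disint hπ, ← integral_sub (hint β) (integrable_conjR hc hK hfin β)]
    refine integral_mono (integrable_finsetSum _ fun n _ => integrable_continuousMap_mul
      ((hint (b n)).sub (integrable_conjR hc hK hfin (b n))) (η n))
      ((hint β).sub (integrable_conjR hc hK hfin β)) fun x => ?_
    have h1 : ∫ y, β (x, y) ∂(disint π x : Measure Y) =
        ∑ n ∈ Finset.range (n₀ + 1), η n x * ∫ y, γ n y ∂(disint π x : Measure Y) := by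
      simp only [β, ContinuousMap.coe_mk]
      rw [integral_finsetSum _ fun n _ => (integrable_continuousMap _ (γ n)).const_mul _]
      simp only [integral_const_mul]
    have h2 : conjR c x (β.curry x) ≤ ∑ n ∈ Finset.range (n₀ + 1), η n x * conjR c x (γ n) := by
      rw [hβ]
      exact (convexOn_conjR hc hK x).map_sum_le (fun n _ => hη0 n x) (hη1 x) fun n _ => mem_univ _
    dsimp only
    rw [h1]
    simp only [mul_sub, Finset.sum_sub_distrib]
    linarith

/-- The integral of `θ` along conditional means is a supremum over continuous selections of
slopes. -/
theorem exists_continuous_integral_theta_le (hθ : ConvexOn ℝ univ θ) (hθ0 : ∀ u, 0 ≤ θ u)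
    (π : ProbabilityMeasure (X × Y)) {δ : ℝ} (hδ : 0 < δ) :
    ∃ l : C(X, Vec M), (∀ x, l x ∈ slopeSet θ f) ∧
      ∫ x, θ (condMean π f x) ∂(μ : Measure X) - δ ≤
        ∫ x, inner ℝ (l x) (condMean π f x) ∂(μ : Measure X) -
          ∫ x, legR θ (l x) ∂(μ : Measure X) := by
  obtain ⟨v, hv, hlub⟩ := exists_seq_isLUB_theta (f := f) hθ hθ0
  have hvint : ∀ n, Integrable (fun x => inner ℝ (v n) (condMean π f x) - legR θ (v n))
      (μ : Measure X) := fun n =>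
    (integrable_inner_condMean π f (ContinuousMap.const X (v n))).sub (integrable_const _)
  obtain ⟨n₀, η, hη0, hη1, hη⟩ := exists_continuous_weights_of_isLUB (μ : Measure X)
    (Φ := fun n x => inner ℝ (v n) (condMean π f x) - legR θ (v n))
    (fun n => (measurable_const.inner (measurable_condMean π f)).sub_const _) hvint
    (integrable_theta_condMean hθ hθ0 f π) (fun x => hlub _ (norm_condMean_le π f x)) hδ
  let l : C(X, Vec M) := ⟨fun x => ∑ n ∈ Finset.range (n₀ + 1), η n x • v n, by fun_prop⟩
  have hl : ∀ x, l x ∈ slopeSet θ f := fun x =>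
    convex_slopeSet.sum_mem (fun n _ => hη0 n x) (hη1 x) fun n _ => hv n
  refine ⟨l, hl, hη.trans ?_⟩
  rw [← integral_sub (integrable_inner_condMean π f l) (integrable_legR θ hl)]
  refine integral_mono (integrable_finsetSum _ fun n _ => integrable_continuousMap_mul (hvint n) _)
    ((integrable_inner_condMean π f l).sub (integrable_legR θ hl)) fun x => ?_
  have h2 : legR θ (l x) ≤ ∑ n ∈ Finset.range (n₀ + 1), η n x * legR θ (v n) :=
    convexOn_legR.map_sum_le (fun n _ => hη0 n x) (hη1 x) fun n _ => hv n
  have h1 : inner ℝ (l x) (condMean π f x) =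
      ∑ n ∈ Finset.range (n₀ + 1), η n x * inner ℝ (v n) (condMean π f x) := by
    simp only [l, ContinuousMap.coe_mk, sum_inner, real_inner_smul_left]
  dsimp only
  rw [h1]
  simp only [mul_sub, Finset.sum_sub_distrib]
  linarith

end Plans

/-! ### Strong duality -/

section StrongDuality

variable {X Y : Type*}
  [MetricSpace X] [CompactSpace X] [MeasurableSpace X] [BorelSpace X]
  [MetricSpace Y] [CompactSpace Y] [MeasurableSpace Y] [BorelSpace Y] [Nonempty Y]
  {M N : ℕ} {c : X → ProbabilityMeasure Y → ℝ≥0∞} {K : Set C(Y, ℝ)}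
  {μ : ProbabilityMeasure X} {ν : ProbabilityMeasure Y}
  {θ : Vec M → ℝ} {f : C(X × Y, Vec M)} {g : C(X × Y, Vec N)}

/-- The dual functional on dual variables where it is finite, as a real number. -/
def realF (μ : ProbabilityMeasure X) (ν : ProbabilityMeasure Y)
    (c : X → ProbabilityMeasure Y → ℝ≥0∞) (θ : Vec M → ℝ) (ξ : DualSpace X Y M N) : ℝ :=
  ∫ x, conjR c x (ξ.2.2.2.2.curry x) ∂(μ : Measure X) + ∫ x, legR θ (dualLam ξ x) ∂(μ : Measure X)
    - ∫ x, ξ.1 x ∂(μ : Measure X) - ∫ y, ξ.2.1 y ∂(ν : Measure Y)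

/-- The dual variables with `β_x ∈ K` for all `x`, slopes in `slopeSet θ f`, and `α` in a given
subspace. -/
def boundedDuals (K : Set C(Y, ℝ)) (θ : Vec M → ℝ) (f : C(X × Y, Vec M))
    (A : Submodule ℝ C(X, Vec N)) : Set (DualSpace X Y M N) :=
  {ξ | (∀ x, ξ.2.2.2.2.curry x ∈ K) ∧ (∀ x, dualLam ξ x ∈ slopeSet θ f) ∧ dualAlpha ξ ∈ A}

theorem integral_combination {Z : Type*} [MetricSpace Z] [CompactSpace Z] [MeasurableSpace Z]
    [BorelSpace Z] (m : Measure Z) [IsFiniteMeasure m] (k k' : C(Z, ℝ)) (s t : ℝ) :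
    ∫ z, (s • k + t • k') z ∂m = s * ∫ z, k z ∂m + t * ∫ z, k' z ∂m := by
  rw [← integral_const_mul, ← integral_const_mul]
  exact integral_add ((integrable_continuousMap _ k).const_mul s)
    ((integrable_continuousMap _ k').const_mul t)

theorem curry_combination (β β' : C(X × Y, ℝ)) (s t : ℝ) (x : X) :
    (s • β + t • β').curry x = s • β.curry x + t • β'.curry x := by
  ext y
  simp

theorem mem_boundedDuals_combination (hK : IsDualSet c K) {A : Submodule ℝ C(X, Vec N)}
    {ξ ξ' : DualSpace X Y M N} (hξ : ξ ∈ boundedDuals K θ f A) (hξ' : ξ' ∈ boundedDuals K θ f A)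
    {s t : ℝ} (hs : 0 ≤ s) (ht : 0 ≤ t) (hst : s + t = 1) :
    s • ξ + t • ξ' ∈ boundedDuals K θ f A := by
  obtain ⟨φ, ψ, l, α, β⟩ := ξ
  obtain ⟨φ', ψ', l', α', β'⟩ := ξ'
  refine ⟨fun x => ?_, fun x => ?_, A.add_mem (A.smul_mem s hξ.2.2) (A.smul_mem t hξ'.2.2)⟩
  · have h := hK.convex (hξ.1 x) (hξ'.1 x) hs ht hst
    rwa [← curry_combination] at h
  · exact convex_slopeSet (hξ.2.1 x) (hξ'.2.1 x) hs ht hst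

theorem convexOn_realF [Nonempty X] (hc : IsWeakCost c) (hK : IsDualSet c K)
    (hfin : ∃ π : ProbabilityMeasure (X × Y), weakCost μ c π < ⊤) (A : Submodule ℝ C(X, Vec N)) :
    ConvexOn ℝ (boundedDuals K θ f A) (realF μ ν c θ) := by
  refine ⟨fun ξ hξ ξ' hξ' s t hs ht hst => mem_boundedDuals_combination hK hξ hξ' hs ht hst,
    fun ξ hξ ξ' hξ' s t hs ht hst => ?_⟩
  have hmem := (mem_boundedDuals_combination hK hξ hξ' hs ht hst).2.1
  obtain ⟨φ, ψ, l, α, β⟩ := ξ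
  obtain ⟨φ', ψ', l', α', β'⟩ := ξ'
  have e1 : ∫ x, conjR c x ((s • β + t • β').curry x) ∂(μ : Measure X) ≤
      s * ∫ x, conjR c x (β.curry x) ∂(μ : Measure X) +
      t * ∫ x, conjR c x (β'.curry x) ∂(μ : Measure X) := by
    have i1 := (integrable_conjR hc hK hfin β).const_mul s
    have i2 := (integrable_conjR hc hK hfin β').const_mul t
    rw [← integral_const_mul, ← integral_const_mul, ← integral_add i1 i2]
    refine integral_mono (integrable_conjR hc hK hfin _) (i1.add i2) fun x => ?_
    dsimp only
    rw [curry_combination]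
    exact (convexOn_conjR hc hK x).2 (mem_univ _) (mem_univ _) hs ht hst
  have e2 : ∫ x, legR θ ((s • l + t • l') x) ∂(μ : Measure X) ≤
      s * ∫ x, legR θ (l x) ∂(μ : Measure X) + t * ∫ x, legR θ (l' x) ∂(μ : Measure X) := by
    have i1 := (integrable_legR (μ := μ) θ hξ.2.1).const_mul s
    have i2 := (integrable_legR (μ := μ) θ hξ'.2.1).const_mul t
    rw [← integral_const_mul, ← integral_const_mul]
    refine (integral_mono (integrable_legR θ hmem) (i1.add i2) fun x => ?_).trans_eq
      (integral_add i1 i2)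
    exact convexOn_legR.2 (hξ.2.1 x) (hξ'.2.1 x) hs ht hst
  simp only [realF, dualLam, Prod.smul_mk, Prod.mk_add_mk, smul_eq_mul]
  rw [integral_combination, integral_combination]
  linarith

theorem Lam_combination (f : C(X × Y, Vec M)) (g : C(X × Y, Vec N)) (ξ ξ' : DualSpace X Y M N)
    (s t : ℝ) : Lam f g (s • ξ + t • ξ') = s • Lam f g ξ + t • Lam f g ξ' := by
  ext z
  obtain ⟨φ, ψ, l, α, β⟩ := ξ
  obtain ⟨φ', ψ', l', α', β'⟩ := ξ'
  simp only [Lam, Prod.smul_mk, ContinuousMap.coe_mk, ContinuousMap.add_apply,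
    ContinuousMap.smul_apply, inner_add_left, real_inner_smul_left, smul_eq_mul]
  ring

/-- Integrals of continuous functions interpolate linearly along mixtures of probability
measures. -/
theorem exists_mixture {Z : Type*} [MetricSpace Z] [CompactSpace Z] [MeasurableSpace Z]
    [BorelSpace Z] (p q : ProbabilityMeasure Z) {s t : ℝ} (hs : 0 ≤ s) (ht : 0 ≤ t)
    (hst : s + t = 1) : ∃ m : ProbabilityMeasure Z, ∀ k : C(Z, ℝ), ∫ z, k z ∂(m : Measure Z) =
      s * ∫ z, k z ∂(p : Measure Z) + t * ∫ z, k z ∂(q : Measure Z) := by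
  let m : Measure Z := ENNReal.ofReal s • (p : Measure Z) + ENNReal.ofReal t • (q : Measure Z)
  have hm : IsProbabilityMeasure m := ⟨by
    simp [m, ← ENNReal.ofReal_add hs ht, hst]⟩
  refine ⟨⟨m, hm⟩, fun k => ?_⟩
  have hi : ∀ (p : ProbabilityMeasure Z) (s : ℝ),
      Integrable (fun z => k z) (ENNReal.ofReal s • (p : Measure Z)) := fun p s =>
    (integrable_continuousMap _ k).smul_measure ENNReal.ofReal_ne_top
  rw [ProbabilityMeasure.coe_mk, integral_add_measure (hi p s) (hi q t), integral_smul_measure,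
    integral_smul_measure, ENNReal.toReal_ofReal hs, ENNReal.toReal_ofReal ht]
  rfl

theorem eq_zero_of_forall_add_mul_le {a b r : ℝ} (h : ∀ t : ℝ, a + t * b ≤ r) : b = 0 := by
  by_contra hb
  have := h ((r - a + 1) / b)
  rw [div_mul_cancel₀ _ hb] at this
  linarith

theorem eq_of_forall_integral_continuousMap_eq {Z : Type*} [MetricSpace Z] [CompactSpace Z]
    [MeasurableSpace Z] [BorelSpace Z] {m m' : Measure Z} [IsFiniteMeasure m] [IsFiniteMeasure m']
    (h : ∀ k : C(Z, ℝ), ∫ z, k z ∂m = ∫ z, k z ∂m') : m = m' :=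
  ext_of_forall_integral_eq_of_IsFiniteMeasure fun k => h k.toContinuousMap

/-- A bound `r` for the penalized dual values forces a plan with penalized cost at most `r`. The
minimax principle is applied to
`∫ (Λξ - h) dπ - F(ξ) - G(h)`, in which `h` decouples the penalty `G` from `ξ`. Dirac masses at
minimum points of `Λξ - h` supply the minimizers, the minimal value being absorbed into `φ`; testing
the resulting `π` against all `(ξ, h)` recovers the constraints and the cost. -/
theorem exists_plan_of_dual_le [Nonempty X] (hθ : ConvexOn ℝ univ θ) (hθ0 : ∀ u, 0 ≤ θ u)
    (hc : IsWeakCost c) (hK : IsDualSet c K)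
    (hfin : ∃ π : ProbabilityMeasure (X × Y), weakCost μ c π < ⊤)
    (A : Submodule ℝ C(X, Vec N))
    (hA : ∀ π ∈ couplings μ ν, (∀ α ∈ A, ∫ x, inner ℝ (α x) (condMean π g x) ∂(μ : Measure X) = 0) →
      π ∈ momentCouplings μ ν g)
    {Q : Set C(X × Y, ℝ)} {G : C(X × Y, ℝ) → ℝ} (hG : ConvexOn ℝ Q G) (hQ : Q.Nonempty) {r : ℝ}
    (hr : ∀ ξ ∈ boundedDuals K θ f A, ∀ h ∈ Q, (∀ z, h z ≤ Lam f g ξ z) →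
      -realF μ ν c θ ξ - G h ≤ r) :
    ∃ π ∈ momentCouplings μ ν g, ∀ h ∈ Q,
      realJ μ c θ f π - ∫ z, h z ∂(π : Measure (X × Y)) - G h ≤ r := by
  let L : ProbabilityMeasure (X × Y) → DualSpace X Y M N × C(X × Y, ℝ) → ℝ := fun π d =>
    ∫ z, (Lam f g d.1 - d.2) z ∂(π : Measure (X × Y)) - (realF μ ν c θ d.1 + G d.2)
  have hF := convexOn_realF (ν := ν) (θ := θ) (f := f) hc hK hfin A
  have : Nonempty (ProbabilityMeasure (X × Y)) :=
    ⟨⟨Measure.dirac (Classical.arbitrary (X × Y)), inferInstance⟩⟩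
  obtain ⟨π, hπ⟩ : ∃ π, ∀ d ∈ boundedDuals K θ f A ×ˢ Q, L π d ≤ r := by
    refine exists_forall_le_of_concaveOn (fun d _ => ?_) (fun p q s t hs ht hst => ?_)
      (fun π => ?_) ?_
    · exact (continuous_integral_continuousMap _).sub continuous_const
    · obtain ⟨m, hm⟩ := exists_mixture p q hs ht hst
      refine ⟨m, fun d _ => ?_⟩
      simp only [L]
      rw [hm]
      obtain rfl : s = 1 - t := by linarith
      ring
    · refine ⟨hF.1.prod hG.1, ?_⟩
      rintro ⟨ξ, h⟩ ⟨hξ, hh⟩ ⟨ξ', h'⟩ ⟨hξ', hh'⟩ s t hs ht hst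
      have h1 := hF.2 hξ hξ' hs ht hst
      have h2 := hG.2 hh hh' hs ht hst
      have h3 : Lam f g (s • ξ + t • ξ') - (s • h + t • h') =
          s • (Lam f g ξ - h) + t • (Lam f g ξ' - h') := by
        rw [Lam_combination, smul_sub, smul_sub]; abel
      simp only [L, Prod.smul_mk, Prod.mk_add_mk, smul_eq_mul] at h1 h2 ⊢
      rw [h3, integral_combination]
      linarith
    · rintro ⟨ξ, h⟩ ⟨hξ, hh⟩
      obtain ⟨z₀, -, hz₀⟩ := isCompact_univ.exists_isMinOn univ_nonempty
        (Lam f g ξ - h).continuous.continuousOn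
      refine ⟨⟨Measure.dirac z₀, inferInstance⟩, ?_⟩
      set m := (Lam f g ξ - h) z₀ with hm
      obtain ⟨φ, ψ, l, α, β⟩ := ξ
      have hshift : ∀ z, Lam f g (φ + ContinuousMap.const X m, ψ, l, α, β) z =
          Lam f g (φ, ψ, l, α, β) z - m := fun z => by
        simp only [Lam, ContinuousMap.coe_mk, ContinuousMap.add_apply, ContinuousMap.const_apply]
        ring
      have h1 := hr (φ + ContinuousMap.const X m, ψ, l, α, β) hξ h hh fun z => by
        have h2 : m ≤ (Lam f g (φ, ψ, l, α, β) - h) z := hz₀ (mem_univ z)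
        rw [ContinuousMap.sub_apply] at h2
        rw [hshift]
        linarith
      have h3 : ∫ x, (φ + ContinuousMap.const X m) x ∂(μ : Measure X) =
          ∫ x, φ x ∂(μ : Measure X) + m := by
        refine (integral_add (integrable_continuousMap _ φ) (integrable_const m)).trans ?_
        simp
      simp only [L, ProbabilityMeasure.coe_mk]
      rw [integral_dirac, ← hm]
      simp only [realF] at h1 ⊢
      rw [h3] at h1
      have : dualLam (φ + ContinuousMap.const X m, ψ, l, α, β) = dualLam (φ, ψ, l, α, β) := rfl
      rw [this] at h1
      linarith
  -- the value of the Lagrangian, with the integrals of the five dual variables separated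
  have hval : ∀ φ ψ l α β h, (φ, ψ, l, α, β) ∈ boundedDuals K θ f A → h ∈ Q →
      ∫ z, β z ∂(π : Measure (X × Y)) + ∫ z, inner ℝ (l z.1) (f z) ∂(π : Measure (X × Y)) +
        ∫ z, inner ℝ (α z.1) (g z) ∂(π : Measure (X × Y)) -
        ∫ z, φ z.1 ∂(π : Measure (X × Y)) - ∫ z, ψ z.2 ∂(π : Measure (X × Y)) -
        ∫ z, h z ∂(π : Measure (X × Y)) -
        (∫ x, conjR c x (β.curry x) ∂(μ : Measure X) + ∫ x, legR θ (l x) ∂(μ : Measure X)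
          - ∫ x, φ x ∂(μ : Measure X) - ∫ y, ψ y ∂(ν : Measure Y)) - G h ≤ r := by
    intro φ ψ l α β h hξ hh
    have h1 := hπ ((φ, ψ, l, α, β), h) ⟨hξ, hh⟩
    have h2 : ∫ z, (Lam f g (φ, ψ, l, α, β) - h) z ∂(π : Measure (X × Y)) = _ :=
      integral_sub (integrable_continuousMap _ _) (integrable_continuousMap _ _)
    simp only [L] at h1
    rw [h2, integral_Lam] at h1
    simp only [realF, dualLam] at h1
    linarith
  obtain ⟨h₀, hh₀⟩ := hQ
  obtain ⟨γ₀, hγ₀⟩ := hK.nonempty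
  obtain ⟨v, hv, -⟩ := exists_seq_isLUB_theta (f := f) hθ hθ0
  let β₀ : C(X × Y, ℝ) := ⟨fun z => γ₀ z.2, by fun_prop⟩
  have hβ₀ : ∀ x, β₀.curry x ∈ K := fun x => hγ₀
  obtain ⟨B, hB⟩ : ∃ B, ∀ (φ : C(X, ℝ)) (ψ : C(Y, ℝ)), ∀ α ∈ A,
      B + ∫ z, inner ℝ (α z.1) (g z) ∂(π : Measure (X × Y)) +
        (∫ x, φ x ∂(μ : Measure X) - ∫ z, φ z.1 ∂(π : Measure (X × Y))) +
        (∫ y, ψ y ∂(ν : Measure Y) - ∫ z, ψ z.2 ∂(π : Measure (X × Y))) ≤ r :=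
    ⟨∫ z, β₀ z ∂(π : Measure (X × Y)) + ∫ z, inner ℝ (v 0) (f z) ∂(π : Measure (X × Y)) -
      ∫ z, h₀ z ∂(π : Measure (X × Y)) - (∫ x, conjR c x (β₀.curry x) ∂(μ : Measure X) +
      ∫ _, legR θ (v 0) ∂(μ : Measure X)) - G h₀, fun φ ψ α hα => by
        have h1 := hval φ ψ (ContinuousMap.const X (v 0)) α β₀ h₀ ⟨hβ₀, fun _ => hv 0, hα⟩ hh₀
        simp only [ContinuousMap.const_apply] at h1
        linarith⟩
  have hfst : (π : Measure (X × Y)).fst = (μ : Measure X) := by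
    refine eq_of_forall_integral_continuousMap_eq fun φ => ?_
    rw [Measure.fst, integral_map measurable_fst.aemeasurable φ.continuous.aestronglyMeasurable]
    refine (sub_eq_zero.1 (eq_zero_of_forall_add_mul_le (a := B) (r := r) fun t => ?_)).symm
    simpa [integral_const_mul, mul_sub] using hB (t • φ) 0 0 A.zero_mem
  have hsnd : (π : Measure (X × Y)).snd = (ν : Measure Y) := by
    refine eq_of_forall_integral_continuousMap_eq fun ψ => ?_
    rw [Measure.snd, integral_map measurable_snd.aemeasurable ψ.continuous.aestronglyMeasurable]
    refine (sub_eq_zero.1 (eq_zero_of_forall_add_mul_le (a := B) (r := r) fun t => ?_)).symm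
    simpa [integral_const_mul, mul_sub] using hB 0 (t • ψ) 0 A.zero_mem
  have hmom : π ∈ momentCouplings μ ν g := by
    refine hA π ⟨hfst, hsnd⟩ fun α hα => ?_
    rw [← integral_inner_eq hfst]
    refine eq_zero_of_forall_add_mul_le (a := B) (r := r) fun t => ?_
    simpa [integral_const_mul, real_inner_smul_left] using hB 0 0 (t • α) (A.smul_mem t hα)
  refine ⟨π, hmom, fun h hh => le_of_forall_pos_le_add fun δ hδ => ?_⟩
  obtain ⟨β, hβ, hβle⟩ := exists_continuous_integral_cost_le hc hK hfin hfst (half_pos hδ)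
  obtain ⟨l, hl, hlle⟩ := exists_continuous_integral_theta_le (μ := μ) (f := f) hθ hθ0 π
    (half_pos hδ)
  have h1 := hval 0 0 l 0 β h ⟨hβ, hl, A.zero_mem⟩ hh
  rw [integral_inner_eq hfst f l] at h1
  simp only [ContinuousMap.zero_apply, inner_zero_left, integral_zero] at h1
  rw [realJ]
  linarith

/-- The moment constraint is detected by continuous test functions. -/
theorem mem_momentCouplings_of_forall {π : ProbabilityMeasure (X × Y)} (hπ : π ∈ couplings μ ν)
    (h : ∀ α : C(X, Vec N), ∫ x, inner ℝ (α x) (condMean π g x) ∂(μ : Measure X) = 0) :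
    π ∈ momentCouplings μ ν g := by
  refine ⟨hπ, ?_⟩
  have hsq : Integrable (fun x => ‖condMean π g x‖ ^ 2) (μ : Measure X) := by
    refine (integrable_const (‖g‖ ^ 2)).mono'
      ((measurable_condMean π g).norm.pow_const 2).aestronglyMeasurable (ae_of_all _ fun x => ?_)
    rw [Real.norm_of_nonneg (by positivity)]
    exact pow_le_pow_left₀ (norm_nonneg _) (norm_condMean_le π g x) 2
  have hzero : ∫ x, ‖condMean π g x‖ ^ 2 ∂(μ : Measure X) = 0 := by
    refine le_antisymm (le_of_forall_pos_le_add fun δ hδ => ?_)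
      (integral_nonneg fun x => by positivity)
    obtain ⟨k, hk, hki⟩ :=
      (integrable_condMean (μ := μ) π g).exists_boundedContinuous_integral_sub_le
        (div_pos hδ (by positivity : (0 : ℝ) < ‖g‖ + 1))
    have h1 := h k.toContinuousMap
    have h2 : ∫ x, ‖condMean π g x‖ ^ 2 ∂(μ : Measure X) -
        ∫ x, inner ℝ (k x) (condMean π g x) ∂(μ : Measure X) ≤
        ∫ x, ‖condMean π g x - k x‖ * (‖g‖ + 1) ∂(μ : Measure X) := by
      have hi : Integrable (fun x => inner ℝ (k x) (condMean π g x)) (μ : Measure X) :=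
        integrable_inner_condMean π g k.toContinuousMap
      rw [← integral_sub hsq hi]
      refine integral_mono (hsq.sub hi) (((integrable_condMean π g).sub hki).norm.mul_const _)
        fun x => ?_
      have h3 := real_inner_le_norm (condMean π g x - k x) (condMean π g x)
      rw [inner_sub_left, real_inner_self_eq_norm_sq] at h3
      refine h3.trans (mul_le_mul_of_nonneg_left ?_ (norm_nonneg _))
      linarith [norm_condMean_le π g x]
    rw [integral_mul_const] at h2
    have h4 := mul_le_mul_of_nonneg_right hk (by positivity : (0 : ℝ) ≤ ‖g‖ + 1)
    rw [div_mul_cancel₀ _ (by positivity)] at h4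
    have h5 : ∫ x, inner ℝ (k x) (condMean π g x) ∂(μ : Measure X) = 0 := h1
    linarith
  filter_upwards [(integral_eq_zero_iff_of_nonneg (fun x => by positivity) hsq).1 hzero] with x hx
  simpa [condMean] using hx

end StrongDuality

/-! ### Minimizers and dual values -/

section Conclusion

/-- The order-theoretic passage from weak duality, and strong duality against the test set `S₀`, to
attainment and to equality of the dual values over all larger sets. -/
theorem exists_minimizer_of_duality {P E : Type*} {A : Set P} {J : P → ℝ≥0∞} {dv : E → EReal}
    {e : ℝ} {S₀ : Set E}
    (hweak : ∀ π ∈ A, ∀ ξ, J π ≠ ⊤ → ((e - (J π).toReal : ℝ) : EReal) ≤ dv ξ)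
    (hfeas : ∃ π ∈ A, J π ≠ ⊤) (hfin : ∃ ξ ∈ S₀, dv ξ ≠ ⊤)
    (hstrong : ∀ r : ℝ, (∀ ξ ∈ S₀, ((e - r : ℝ) : EReal) ≤ dv ξ) →
      ∃ π ∈ A, J π ≠ ⊤ ∧ (J π).toReal ≤ r) :
    ∃ π ∈ A, (∀ π' ∈ A, J π ≤ J π') ∧ J π ≠ ⊤ ∧
      ∀ S, S₀ ⊆ S → ⨅ ξ ∈ S, dv ξ = ((e - (J π).toReal : ℝ) : EReal) := by
  obtain ⟨π₀, hπ₀, hJ₀⟩ := hfeas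
  obtain ⟨ξ₀, hξ₀, hd₀⟩ := hfin
  have hle : ⨅ ξ ∈ S₀, dv ξ ≤ dv ξ₀ := iInf₂_le ξ₀ hξ₀
  have hge : ∀ π ∈ A, J π ≠ ⊤ → ((e - (J π).toReal : ℝ) : EReal) ≤ ⨅ ξ ∈ S₀, dv ξ :=
    fun π hπ hJ => le_iInf₂ fun ξ _ => hweak π hπ ξ hJ
  obtain ⟨v, hv⟩ : ∃ v : ℝ, ⨅ ξ ∈ S₀, dv ξ = v :=
    ⟨_, (EReal.coe_toReal (ne_top_of_le_ne_top hd₀ hle)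
      (ne_bot_of_le_ne_bot (EReal.coe_ne_bot _) (hge π₀ hπ₀ hJ₀))).symm⟩
  rw [hv] at hge
  obtain ⟨π, hπ, hJ, hJr⟩ := hstrong (e - v) fun ξ hξ => by
    rw [sub_sub_cancel, ← hv]
    exact iInf₂_le ξ hξ
  have heq : v = e - (J π).toReal := by
    have := EReal.coe_le_coe_iff.1 (hge π hπ hJ)
    linarith
  refine ⟨π, hπ, fun π' hπ' => ?_, hJ, fun S hS => le_antisymm ?_ ?_⟩
  · by_cases hJ' : J π' = ⊤
    · rw [hJ']; exact le_top
    · have := EReal.coe_le_coe_iff.1 (hge π' hπ' hJ')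
      exact (ENNReal.toReal_le_toReal hJ hJ').1 (by linarith)
  · rw [← heq, ← hv]
    exact iInf_le_iInf_of_subset hS
  · exact le_iInf₂ fun ξ _ => hweak π hπ ξ hJ

variable {X Y : Type*}
  [MetricSpace X] [CompactSpace X] [MeasurableSpace X] [BorelSpace X]
  [MetricSpace Y] [CompactSpace Y] [MeasurableSpace Y] [BorelSpace Y] [Nonempty Y]
  {M N : ℕ} {c : X → ProbabilityMeasure Y → ℝ≥0∞} {K : Set C(Y, ℝ)}
  {μ : ProbabilityMeasure X} {ν : ProbabilityMeasure Y}
  {θ : Vec M → ℝ} {f : C(X × Y, Vec M)} {g : C(X × Y, Vec N)}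

theorem dualF_eq_realF [Nonempty X] (hc : IsWeakCost c) (hK : IsDualSet c K)
    (hfin : ∃ π : ProbabilityMeasure (X × Y), weakCost μ c π < ⊤)
    {A : Submodule ℝ C(X, Vec N)} {ξ : DualSpace X Y M N} (hξ : ξ ∈ boundedDuals K θ f A) :
    dualF μ ν c θ K ξ = (realF μ ν c θ ξ : EReal) := by
  obtain ⟨φ, ψ, l, α, β⟩ := ξ
  exact dualF_eq_coe hc hK hfin φ ψ α hξ.2.1 hξ.1

theorem boundedDuals_subset_boundedLam (A : Submodule ℝ C(X, Vec N)) :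
    boundedDuals K θ f A ⊆ boundedLam N θ f := fun _ hξ =>
  (ContinuousMap.norm_le _ (NNReal.coe_nonneg _)).2 fun x => (hξ.2.1 x).1

/-- The continuous `ℝ^N`-valued functions with mean zero. -/
def zeroMean (μ : ProbabilityMeasure X) (N : ℕ) : Submodule ℝ C(X, Vec N) where
  carrier := {α | ∫ x, α x ∂(μ : Measure X) = 0}
  zero_mem' := by simp
  add_mem' := fun {α α'} h h' => by
    have e : ∫ x, (α + α') x ∂(μ : Measure X) = _ :=
      integral_add (integrable_continuousMap _ α) (integrable_continuousMap _ α')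
    exact e.trans ((congrArg₂ (· + ·) h h').trans (add_zero 0))
  smul_mem' := fun s α h => by
    have e : ∫ x, (s • α) x ∂(μ : Measure X) = _ := integral_smul s _
    exact e.trans ((congrArg (s • ·) h).trans (smul_zero s))

/-- If all couplings have zero `g`-moment, mean-zero test functions detect the moment
constraint: the mean of `α` only sees the total moment. -/
theorem mem_momentCouplings_of_zeroMean
    (hg : ∀ π ∈ couplings μ ν, ∫ z, g z ∂(π : Measure (X × Y)) = 0)
    {π : ProbabilityMeasure (X × Y)} (hπ : π ∈ couplings μ ν)
    (h : ∀ α ∈ zeroMean μ N, ∫ x, inner ℝ (α x) (condMean π g x) ∂(μ : Measure X) = 0) :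
    π ∈ momentCouplings μ ν g := by
  refine mem_momentCouplings_of_forall hπ fun α => ?_
  let a : Vec N := ∫ x, α x ∂(μ : Measure X)
  have hα : α - ContinuousMap.const X a ∈ zeroMean μ N := by
    have e : ∫ x, (α - ContinuousMap.const X a) x ∂(μ : Measure X) = _ :=
      integral_sub (integrable_continuousMap _ α) (integrable_const a)
    exact e.trans (by simp [a])
  have h0 : ∫ x, condMean π g x ∂(μ : Measure X) = 0 := by
    rw [← hg π hπ, ← hπ.1]
    exact Measure.integral_condKernel (integrable_continuousMap _ g)
  have h1 : ∫ x, inner ℝ a (condMean π g x) ∂(μ : Measure X) = 0 := by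
    rw [integral_inner (integrable_condMean π g), h0, inner_zero_right]
  have h2 := h _ hα
  have h3 : ∫ x, inner ℝ ((α - ContinuousMap.const X a) x) (condMean π g x) ∂(μ : Measure X) =
      ∫ x, inner ℝ (α x) (condMean π g x) ∂(μ : Measure X) -
        ∫ x, inner ℝ a (condMean π g x) ∂(μ : Measure X) := by
    have hi : Integrable (fun x => inner ℝ a (condMean π g x)) (μ : Measure X) :=
      integrable_inner_condMean π g (ContinuousMap.const X a)
    rw [← integral_sub (integrable_inner_condMean π g α) hi]
    simp [inner_sub_left]
  rw [h2, h1] at h3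
  linarith

theorem exists_mem_boundedDuals [Nonempty X] (hθ : ConvexOn ℝ univ θ) (hθ0 : ∀ u, 0 ≤ θ u)
    (hK : IsDualSet c K) (A : Submodule ℝ C(X, Vec N)) :
    ∃ ξ ∈ boundedDuals K θ f A, ∀ z, 0 ≤ Lam f g ξ z := by
  obtain ⟨γ₀, hγ₀⟩ := hK.nonempty
  obtain ⟨v, hv, -⟩ := exists_seq_isLUB_theta (f := f) hθ hθ0
  let β₀ : C(X × Y, ℝ) := ⟨fun z => γ₀ z.2, by fun_prop⟩
  let ξ₀ : DualSpace X Y M N := (0, 0, ContinuousMap.const X (v 0), 0, β₀)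
  refine ⟨(ContinuousMap.const X (-‖Lam f g ξ₀‖), 0, ContinuousMap.const X (v 0), 0, β₀),
    ⟨fun _ => hγ₀, fun _ => hv 0, A.zero_mem⟩, fun z => ?_⟩
  have h1 := (abs_le.1 ((Lam f g ξ₀).norm_coe_le_norm z)).1
  have h2 : Lam f g (ContinuousMap.const X (-‖Lam f g ξ₀‖), 0, ContinuousMap.const X (v 0), 0, β₀) z
      = Lam f g ξ₀ z + ‖Lam f g ξ₀‖ := by
    simp [ξ₀, Lam]
  rw [h2]
  linarith

/-- Duality for the unregularized problem, with the dual variables restricted to any set containing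
`boundedDuals K θ f A`. -/
theorem exists_minimizer_primalJ (hθ : ConvexOn ℝ univ θ) (hθ0 : ∀ u, 0 ≤ θ u)
    (hc : IsWeakCost c) (hK : IsDualSet c K)
    (hfeas : ∃ π ∈ momentCouplings μ ν g, weakCost μ c π < ⊤) (A : Submodule ℝ C(X, Vec N))
    (hA : ∀ π ∈ couplings μ ν, (∀ α ∈ A, ∫ x, inner ℝ (α x) (condMean π g x) ∂(μ : Measure X) = 0) →
      π ∈ momentCouplings μ ν g) :
    ∃ π ∈ momentCouplings μ ν g, (∀ π' ∈ momentCouplings μ ν g,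
        primalJ μ c θ f π ≤ primalJ μ c θ f π') ∧ primalJ μ c θ f π ≠ ⊤ ∧
      ∀ S, boundedDuals K θ f A ⊆ S →
        dualInf μ ν c θ f g K S = ((0 - (primalJ μ c θ f π).toReal : ℝ) : EReal) := by
  have : Nonempty X := nonempty_of_isProbabilityMeasure (μ : Measure X)
  have hfin : ∃ π : ProbabilityMeasure (X × Y), weakCost μ c π < ⊤ :=
    hfeas.imp fun π hπ => hπ.2
  have hJ := primalJ_eq_ofReal (μ := μ) (f := f) hθ hθ0 hc hK hfin
  have hJr : ∀ π, (primalJ μ c θ f π).toReal = realJ μ c θ f π := fun π => by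
    rw [hJ, ENNReal.toReal_ofReal (realJ_nonneg hθ0 π)]
  refine exists_minimizer_of_duality (fun π hπ ξ _ => ?_) ?_ ?_ fun r hr => ?_
  · rw [hJr]
    rcases dualF_eq_top_or_exists (ν := ν) hθ hθ0 hc hK hfin g ξ with h | ⟨F, hF, h⟩
    · rw [h, penalty]
      split_ifs <;> simp
    · rw [hF, penalty]
      split_ifs with hpos
      · rw [add_zero, EReal.coe_le_coe_iff]
        have : 0 ≤ ∫ z, Lam f g ξ z ∂(π : Measure (X × Y)) := integral_nonneg hpos
        linarith [h π hπ]
      · simp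
  · obtain ⟨π, hπ, -⟩ := hfeas
    exact ⟨π, hπ, by rw [hJ]; exact ENNReal.ofReal_ne_top⟩
  · obtain ⟨ξ, hξ, hpos⟩ := exists_mem_boundedDuals (f := f) (g := g) hθ hθ0 hK A
    refine ⟨ξ, hξ, ?_⟩
    rw [dualF_eq_realF hc hK hfin hξ, penalty, if_pos hpos, add_zero]
    exact EReal.coe_ne_top _
  · obtain ⟨π, hπ, h⟩ := exists_plan_of_dual_le hθ hθ0 hc hK hfin A hA (Q := {0}) (G := fun _ => 0)
      (r := r) ⟨convex_singleton 0, fun _ _ _ _ _ _ _ _ _ => by simp⟩ (singleton_nonempty 0)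
      fun ξ hξ h hh hle => by
        have hpos : ∀ z, 0 ≤ Lam f g ξ z := fun z => by simpa [mem_singleton_iff.1 hh] using hle z
        have h1 := hr ξ hξ
        rw [dualF_eq_realF hc hK hfin hξ, penalty, if_pos hpos, add_zero,
          EReal.coe_le_coe_iff] at h1
        linarith
    refine ⟨π, hπ, by rw [hJ]; exact ENNReal.ofReal_ne_top, ?_⟩
    have := h 0 rfl
    rw [hJr]
    simpa using this

theorem integrable_exp_neg_div (ε : ℝ) (m : Measure (X × Y)) [IsFiniteMeasure m]
    (h : C(X × Y, ℝ)) : Integrable (fun z => Real.exp (-(h z) / ε)) m :=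
  integrable_continuousMap m ⟨fun z => Real.exp (-(h z) / ε), by fun_prop⟩

theorem convexOn_penaltyEps {ε : ℝ} (hε : 0 < ε) :
    ConvexOn ℝ univ fun h : C(X × Y, ℝ) => penaltyEps ε μ ν h - ε := by
  refine ⟨convex_univ, fun h _ h' _ s t hs ht hst => ?_⟩
  have hi := integrable_exp_neg_div ε ((μ : Measure X).prod (ν : Measure Y))
  have h1 : ∫ z, Real.exp (-((s • h + t • h') z) / ε) ∂((μ : Measure X).prod (ν : Measure Y)) ≤
      s * ∫ z, Real.exp (-(h z) / ε) ∂((μ : Measure X).prod (ν : Measure Y)) +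
      t * ∫ z, Real.exp (-(h' z) / ε) ∂((μ : Measure X).prod (ν : Measure Y)) := by
    rw [← integral_const_mul, ← integral_const_mul]
    refine (integral_mono (hi _) (((hi h).const_mul s).add ((hi h').const_mul t))
      fun z => ?_).trans_eq (integral_add ((hi h).const_mul s) ((hi h').const_mul t))
    have h2 := convexOn_exp.2 (mem_univ (-(h z) / ε)) (mem_univ (-(h' z) / ε)) hs ht hst
    simp only [smul_eq_mul] at h2
    refine le_trans (le_of_eq ?_) h2
    simp only [ContinuousMap.add_apply, ContinuousMap.smul_apply, smul_eq_mul]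
    congr 1
    ring
  have h3 := mul_le_mul_of_nonneg_left h1 hε.le
  simp only [penaltyEps, smul_eq_mul]
  obtain rfl : s = 1 - t := by linarith
  linarith

theorem penaltyEps_antitone {ε : ℝ} (hε : 0 < ε) {h h' : C(X × Y, ℝ)} (hle : ∀ z, h z ≤ h' z) :
    penaltyEps ε μ ν h' ≤ penaltyEps ε μ ν h := by
  refine mul_le_mul_of_nonneg_left (integral_mono (integrable_exp_neg_div ε _ h')
    (integrable_exp_neg_div ε _ h) fun z => Real.exp_le_exp.2 ?_) hε.le
  have := hle z
  gcongr

/-- The entropic penalty paired with the integral, in terms of the rescaled test function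
`k = -h / ε`. -/
theorem integral_add_penaltyEps {ε : ℝ} (hε : 0 < ε) (π : ProbabilityMeasure (X × Y))
    (k : C(X × Y, ℝ)) :
    ∫ z, (-ε • k) z ∂(π : Measure (X × Y)) + penaltyEps ε μ ν (-ε • k) - ε =
      -(ε * (∫ z, k z ∂(π : Measure (X × Y)) -
        ∫ z, Real.exp (k z) ∂((μ : Measure X).prod (ν : Measure Y)) + 1)) := by
  have h1 : ∀ z, -((-ε • k) z) / ε = k z := fun z => by
    simp only [ContinuousMap.smul_apply, smul_eq_mul]
    field_simp
  simp only [penaltyEps, h1]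
  simp only [ContinuousMap.smul_apply, smul_eq_mul, integral_const_mul]
  ring

/-- Duality for the entropic problem, with the dual variables restricted to any set containing
`boundedDuals K θ f A`. -/
theorem exists_minimizer_primalJEps {ε : ℝ} (hε : 0 < ε) (hθ : ConvexOn ℝ univ θ)
    (hθ0 : ∀ u, 0 ≤ θ u) (hc : IsWeakCost c) (hK : IsDualSet c K)
    (hfeas : ∃ π ∈ momentCouplings μ ν g,
      weakCost μ c π + ENNReal.ofReal ε * entropy μ ν π < ⊤) (A : Submodule ℝ C(X, Vec N))
    (hA : ∀ π ∈ couplings μ ν, (∀ α ∈ A, ∫ x, inner ℝ (α x) (condMean π g x) ∂(μ : Measure X) = 0) →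
      π ∈ momentCouplings μ ν g) :
    ∃ π ∈ momentCouplings μ ν g, (∀ π' ∈ momentCouplings μ ν g,
        primalJEps ε μ ν c θ f π ≤ primalJEps ε μ ν c θ f π') ∧ primalJEps ε μ ν c θ f π ≠ ⊤ ∧
      ∀ S, boundedDuals K θ f A ⊆ S →
        dualInfEps ε μ ν c θ f g K S = ((ε - (primalJEps ε μ ν c θ f π).toReal : ℝ) : EReal) := by
  have : Nonempty X := nonempty_of_isProbabilityMeasure (μ : Measure X)
  have hfin : ∃ π : ProbabilityMeasure (X × Y), weakCost μ c π < ⊤ :=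
    hfeas.imp fun π hπ => lt_of_le_of_lt le_self_add hπ.2
  have hε0 : ENNReal.ofReal ε ≠ 0 := by simpa using hε
  have hJ : ∀ π, primalJEps ε μ ν c θ f π =
      ENNReal.ofReal (realJ μ c θ f π) + ENNReal.ofReal ε * entropy μ ν π := fun π => by
    rw [primalJEps, primalJ_eq_ofReal hθ hθ0 hc hK hfin]
  have hJtop : ∀ π, primalJEps ε μ ν c θ f π ≠ ⊤ ↔ entropy μ ν π ≠ ⊤ := fun π => by
    simp [hJ, ENNReal.mul_eq_top, hε0]
  have hJr : ∀ π, entropy μ ν π ≠ ⊤ → (primalJEps ε μ ν c θ f π).toReal =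
      realJ μ c θ f π + ε * (entropy μ ν π).toReal := fun π hπ => by
    rw [hJ, ENNReal.toReal_add ENNReal.ofReal_ne_top (ENNReal.mul_ne_top ENNReal.ofReal_ne_top hπ),
      ENNReal.toReal_mul, ENNReal.toReal_ofReal (realJ_nonneg hθ0 π), ENNReal.toReal_ofReal hε.le]
  refine exists_minimizer_of_duality (fun π hπ ξ htop => ?_) ?_ ?_ fun r hr => ?_
  · have hH := (hJtop π).1 htop
    rw [hJr π hH]
    rcases dualF_eq_top_or_exists (ν := ν) hθ hθ0 hc hK hfin g ξ with h | ⟨F, hF, h⟩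
    · rw [h, EReal.top_add_coe]
      exact le_top
    · rw [hF, ← EReal.coe_add, EReal.coe_le_coe_iff]
      let k : C(X × Y, ℝ) := -ε⁻¹ • Lam f g ξ
      have hk : -ε • k = Lam f g ξ := by
        rw [smul_smul, neg_mul_neg, mul_inv_cancel₀ hε.ne', one_smul]
      have h1 := mul_le_mul_of_nonneg_left (integral_sub_integral_exp_le_klDiv hH k) hε.le
      have h2 := integral_add_penaltyEps (μ := μ) (ν := ν) hε π k
      rw [hk] at h2
      have h3 := h π hπ
      simp only [entropy] at h1 ⊢
      linarith
  · obtain ⟨π, hπ, hlt⟩ := hfeas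
    refine ⟨π, hπ, (hJtop π).2 fun h => ?_⟩
    rw [h, ENNReal.mul_top hε0, add_top] at hlt
    exact lt_irrefl _ hlt
  · obtain ⟨ξ, hξ, -⟩ := exists_mem_boundedDuals (f := f) (g := g) hθ hθ0 hK A
    refine ⟨ξ, hξ, ?_⟩
    rw [dualF_eq_realF hc hK hfin hξ, ← EReal.coe_add]
    exact EReal.coe_ne_top _
  · obtain ⟨π, hπ, h⟩ := exists_plan_of_dual_le hθ hθ0 hc hK hfin A hA
      (convexOn_penaltyEps (μ := μ) (ν := ν) hε) univ_nonempty (r := r) fun ξ hξ h _ hle => by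
        have h1 := hr ξ hξ
        rw [dualF_eq_realF hc hK hfin hξ, ← EReal.coe_add, EReal.coe_le_coe_iff] at h1
        have h2 := penaltyEps_antitone (μ := μ) (ν := ν) hε hle
        linarith
    have hbound : ∀ k : C(X × Y, ℝ), ∫ z, k z ∂(π : Measure (X × Y)) -
        ∫ z, Real.exp (k z) ∂((μ : Measure X).prod (ν : Measure Y)) + 1 ≤
        (r - realJ μ c θ f π) / ε := fun k => by
      rw [le_div_iff₀ hε]
      have h1 := h (-ε • k) (mem_univ _)
      have h2 := integral_add_penaltyEps (μ := μ) (ν := ν) hε π k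
      linarith
    have hH := klDiv_le_of_forall_continuousMap hbound
    have hnonneg : 0 ≤ (r - realJ μ c θ f π) / ε := by simpa using hbound 0
    have hHtop : entropy μ ν π ≠ ⊤ := ne_top_of_le_ne_top ENNReal.ofReal_ne_top hH
    refine ⟨π, hπ, (hJtop π).2 hHtop, ?_⟩
    have h1 : (entropy μ ν π).toReal ≤ (r - realJ μ c θ f π) / ε :=
      ENNReal.toReal_le_of_le_ofReal hnonneg hH
    rw [le_div_iff₀ hε] at h1
    rw [hJr π hHtop]
    linarith

end Conclusion

end WeakOT

end

theorem theorem3p1 {X Y : Type*}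
    [MetricSpace X] [CompactSpace X] [MeasurableSpace X] [BorelSpace X]
    [MetricSpace Y] [CompactSpace Y] [MeasurableSpace Y] [BorelSpace Y] [Nonempty Y]
    {M N : ℕ} (μ : ProbabilityMeasure X) (ν : ProbabilityMeasure Y)
    (f : C(X × Y, WeakOT.Vec M)) (g : C(X × Y, WeakOT.Vec N))
    (θ : WeakOT.Vec M → ℝ) (hθ_nonneg : ∀ u, 0 ≤ θ u) (hθ_convex : ConvexOn ℝ Set.univ θ)
    (c : X → ProbabilityMeasure Y → ℝ≥0∞) (hc : WeakOT.IsWeakCost c)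
    (hfeas : ∃ π ∈ WeakOT.momentCouplings μ ν g, WeakOT.weakCost μ c π < ⊤)
    (K : Set C(Y, ℝ)) (hK : WeakOT.IsDualSet c K) :
    -- duality and existence of a minimizer for the unregularized problem
    (∃ π ∈ WeakOT.momentCouplings μ ν g,
      (∀ π' ∈ WeakOT.momentCouplings μ ν g,
        WeakOT.primalJ μ c θ f π ≤ WeakOT.primalJ μ c θ f π') ∧
      ((WeakOT.primalJ μ c θ f π : ℝ≥0∞) : EReal) =
        ⨆ ξ ∈ {ξ : WeakOT.DualSpace X Y M N | ∀ z, 0 ≤ WeakOT.Lam f g ξ z},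
          -WeakOT.dualF μ ν c θ K ξ) ∧
    -- additional constraints in the unregularized dual problem
    WeakOT.dualInf μ ν c θ f g K (WeakOT.boundedLam N θ f) =
      WeakOT.dualInf μ ν c θ f g K Set.univ ∧
    ((∀ π ∈ WeakOT.couplings μ ν, ∫ z, g z ∂(π : Measure (X × Y)) = 0) →
      WeakOT.dualInf μ ν c θ f g K (WeakOT.zeroMeanAlpha M μ) =
        WeakOT.dualInf μ ν c θ f g K Set.univ ∧
      WeakOT.dualInf μ ν c θ f g K (WeakOT.boundedLam N θ f ∩ WeakOT.zeroMeanAlpha M μ) =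
        WeakOT.dualInf μ ν c θ f g K Set.univ) ∧
    -- the entropic problem
    ∀ ε : ℝ, 0 < ε →
      (∃ π ∈ WeakOT.momentCouplings μ ν g,
        WeakOT.weakCost μ c π + ENNReal.ofReal ε * WeakOT.entropy μ ν π < ⊤) →
      (∃ π ∈ WeakOT.momentCouplings μ ν g,
        (∀ π' ∈ WeakOT.momentCouplings μ ν g,
          WeakOT.primalJEps ε μ ν c θ f π ≤ WeakOT.primalJEps ε μ ν c θ f π') ∧
        ((WeakOT.primalJEps ε μ ν c θ f π : ℝ≥0∞) : EReal) =
          (⨆ ξ : WeakOT.DualSpace X Y M N,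
            (-WeakOT.dualF μ ν c θ K ξ -
              ((WeakOT.penaltyEps ε μ ν (WeakOT.Lam f g ξ) : ℝ) : EReal))) + (ε : EReal)) ∧
      WeakOT.dualInfEps ε μ ν c θ f g K (WeakOT.boundedLam N θ f) =
        WeakOT.dualInfEps ε μ ν c θ f g K Set.univ ∧
      ((∀ π ∈ WeakOT.couplings μ ν, ∫ z, g z ∂(π : Measure (X × Y)) = 0) →
        WeakOT.dualInfEps ε μ ν c θ f g K (WeakOT.zeroMeanAlpha M μ) =
          WeakOT.dualInfEps ε μ ν c θ f g K Set.univ ∧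
        WeakOT.dualInfEps ε μ ν c θ f g K (WeakOT.boundedLam N θ f ∩ WeakOT.zeroMeanAlpha M μ) =
          WeakOT.dualInfEps ε μ ν c θ f g K Set.univ) := by
  have hfin : ∃ π : ProbabilityMeasure (X × Y), WeakOT.weakCost μ c π < ⊤ :=
    hfeas.imp fun π hπ => hπ.2
  have : Nonempty X := nonempty_of_isProbabilityMeasure (μ : Measure X)
  have hbot : ∀ ξ : WeakOT.DualSpace X Y M N, WeakOT.dualF μ ν c θ K ξ ≠ ⊥ := fun ξ => by
    rcases WeakOT.dualF_eq_top_or_exists (ν := ν) (f := f) hθ_convex hθ_nonneg hc hK hfin g ξ with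
      h | ⟨F, hF, -⟩
    · simp [h]
    · simp [hF]
  have hsub : WeakOT.boundedDuals K θ f (WeakOT.zeroMean μ N) ⊆
      WeakOT.zeroMeanAlpha M μ := fun ξ hξ => hξ.2.2
  have hsub' := subset_inter (WeakOT.boundedDuals_subset_boundedLam (K := K) (θ := θ) (f := f)
    (WeakOT.zeroMean μ N)) hsub
  have hall : ∀ π ∈ WeakOT.couplings μ ν, (∀ α ∈ (⊤ : Submodule ℝ C(X, WeakOT.Vec N)),
      ∫ x, inner ℝ (α x) (WeakOT.condMean π g x) ∂(μ : Measure X) = 0) →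
      π ∈ WeakOT.momentCouplings μ ν g := fun π hπ h =>
    WeakOT.mem_momentCouplings_of_forall hπ fun α => h α Submodule.mem_top
  obtain ⟨π, hπ, hmin, htop, hinf⟩ :=
    WeakOT.exists_minimizer_primalJ hθ_convex hθ_nonneg hc hK hfeas (f := f) ⊤ hall
  have huniv := hinf univ (subset_univ _)
  refine ⟨⟨π, hπ, hmin, ?_⟩, ?_, fun hg => ?_, fun ε hε hfeasε => ?_⟩
  · have hJ : ((WeakOT.primalJ μ c θ f π : ℝ≥0∞) : EReal) =
        -WeakOT.dualInf μ ν c θ f g K univ := by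
      rw [huniv, zero_sub, EReal.coe_neg, neg_neg, EReal.coe_ennreal_toReal htop]
    rw [hJ]
    refine le_antisymm ?_ (iSup₂_le fun ξ hξ => ?_)
    · rw [EReal.neg_le]
      refine le_iInf₂ fun ξ _ => ?_
      by_cases hξ : ∀ z, 0 ≤ WeakOT.Lam f g ξ z
      · rw [WeakOT.penalty, if_pos hξ, add_zero, EReal.neg_le]
        exact le_iSup₂ (f := fun ξ (_ : ξ ∈ {ξ : WeakOT.DualSpace X Y M N |
          ∀ z, 0 ≤ WeakOT.Lam f g ξ z}) => -WeakOT.dualF μ ν c θ K ξ) ξ hξ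
      · rw [WeakOT.penalty, if_neg hξ, EReal.add_top_of_ne_bot (hbot ξ)]
        exact le_top
    · rw [EReal.neg_le_neg_iff]
      have hpos : ∀ z, 0 ≤ WeakOT.Lam f g ξ z := hξ
      refine (iInf₂_le ξ (mem_univ ξ)).trans_eq ?_
      rw [WeakOT.penalty, if_pos hpos, add_zero]
  · rw [huniv, hinf _ (WeakOT.boundedDuals_subset_boundedLam _)]
  · obtain ⟨π₀, -, -, -, hinf₀⟩ := WeakOT.exists_minimizer_primalJ hθ_convex hθ_nonneg hc hK hfeas
      (f := f) (WeakOT.zeroMean μ N) fun π hπ => WeakOT.mem_momentCouplings_of_zeroMean hg hπ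
    rw [hinf₀ _ (subset_univ _), hinf₀ _ hsub, hinf₀ _ hsub']
    exact ⟨rfl, rfl⟩
  obtain ⟨π, hπ, hmin, htop, hinf⟩ :=
    WeakOT.exists_minimizer_primalJEps hε hθ_convex hθ_nonneg hc hK hfeasε (f := f) ⊤ hall
  have huniv := hinf univ (subset_univ _)
  refine ⟨⟨π, hπ, hmin, ?_⟩, ?_, fun hg => ?_⟩
  · have hsup : (⨆ ξ : WeakOT.DualSpace X Y M N, (-WeakOT.dualF μ ν c θ K ξ -
        ((WeakOT.penaltyEps ε μ ν (WeakOT.Lam f g ξ) : ℝ) : EReal))) =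
        -WeakOT.dualInfEps ε μ ν c θ f g K univ := by
      have hneg : ∀ ξ : WeakOT.DualSpace X Y M N, -WeakOT.dualF μ ν c θ K ξ -
          ((WeakOT.penaltyEps ε μ ν (WeakOT.Lam f g ξ) : ℝ) : EReal) =
          -(WeakOT.dualF μ ν c θ K ξ +
            ((WeakOT.penaltyEps ε μ ν (WeakOT.Lam f g ξ) : ℝ) : EReal)) := fun ξ =>
        (EReal.neg_add (Or.inl (hbot ξ)) (Or.inr (EReal.coe_ne_bot _))).symm
      simp_rw [hneg]
      refine le_antisymm (iSup_le fun ξ => ?_) ?_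
      · rw [EReal.neg_le_neg_iff]
        exact iInf₂_le ξ (mem_univ ξ)
      · rw [EReal.neg_le]
        refine le_iInf₂ fun ξ _ => ?_
        rw [EReal.neg_le]
        exact le_iSup (fun ξ => -(WeakOT.dualF μ ν c θ K ξ +
            ((WeakOT.penaltyEps ε μ ν (WeakOT.Lam f g ξ) : ℝ) : EReal))) ξ
    rw [hsup, huniv, ← EReal.coe_neg, ← EReal.coe_add, neg_sub, sub_add_cancel,
      EReal.coe_ennreal_toReal htop]
  · rw [huniv, hinf _ (WeakOT.boundedDuals_subset_boundedLam _)]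
  · obtain ⟨π₀, -, -, -, hinf₀⟩ := WeakOT.exists_minimizer_primalJEps hε hθ_convex hθ_nonneg hc hK
      hfeasε (f := f) (WeakOT.zeroMean μ N) fun π hπ =>
        WeakOT.mem_momentCouplings_of_zeroMean hg hπ
    rw [hinf₀ _ (subset_univ _), hinf₀ _ hsub, hinf₀ _ hsub']
    exact ⟨rfl, rfl⟩
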